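/- Let $\mathcal G$ be the belt buckle (two vertices joined by three edges), and let $A$ be the transition matrix on its six directed edges: $A(e,e')=1$ if $e'$ begins where $e$ ends and $e'\neq\bar e$, and $A(e,e')=0$ otherwise. For $l=(l_1,l_2,l_3)\in\mathbb R_{>0}^3$, viewed as edge lengths, let $h(l)=\lim_{T\to\infty}\frac1T\log\#\{\gamma:\ l(\gamma)<T\}$, where $\gamma$ runs over closed cycles of directed edges without backtracking, and let $\mathcal M^1=\{l\in\mathbb R_{>0}^3: h(l)=1\}$. Let $\Sigma_A^+$ be the one-sided subshift of finite type of $A$ with shift $\sigma$; a function $\varphi$ on the edges is viewed as the function $\varphi(\underline e)=\varphi(e_0)$ on $\Sigma_A^+$. For a potential $f$ of pressure zero let $m_f=v\mu/\int v\,d\mu$ be its equilibrium state, where $v>0$ is continuous with $\mathcal L_fv=v$, $\mu$ is a probability measure with $\mathcal L_f^*\mu=\mu$, and $\mathcal L_fw(\underline x)=\sum_{\sigma\underline y=\underline x}e^{f(\underline y)}w(\underline y)$. The pressure metric is $$\|\varphi\|_P^2=\mathrm{Var}(\varphi,m_{-l})=\lim_{n\to\infty}\frac1n\int\Big(\sum_{i<n}\varphi\circ\sigma^i-n\int\varphi\,dm_{-l}\Big)^2dm_{-l}$$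 for tangent vectors $\varphi$ at $l$, i.e. functions on the edges with $\int\varphi\,dm_{-l}=0$; $d_P$ is the infimum of the $\|\cdot\|_P$-lengths of $C^1$ curves in $\mathcal M^1$. For $x,y>0$ put $S(x,y)=-\log\frac{e^{x+y}-1}{e^x+e^y+2}$ and $l(x,y)=(x,y,S(x,y))$. 1. $\mathcal M^1=\{l(x,y): x,y>0,\ e^{x+y}<3+e^x+e^y\}$. For all $x,y>0$ (also where $S(x,y)\le 0$) the potential $-l(x,y)$ has a unique equilibrium state, the limit defining $\|\varphi\|_P^2$ exists for every function $\varphi$ on the edges, $\partial_xl$ and $\partial_yl$ are tangent vectors, and the first fundamental form of $\|\cdot\|_P$ in the coordinates $(x,y)$ is a smooth Riemannian metric on $\{x,y>0\}$. Let $K_P(x,y)$ denote its Gaussian curvature. 2. There are constants $0<c_0\le c_1$ such that $c_0\le K_P\le c_1$ on all of $\mathcal M^1$. 3. For all $x,y>0$, with $a=e^x$ and $b=e^y$, $K_P(x,y)=\dfrac{N(a,b)}{4(a+1)^2(b+1)^2(3ab+a^2b+ab^2-1)}$, where $$\begin{aligned}N(a,b)={}&5+6a+3a^2+6b+3b^2+3ab+45a^2b^2+19a^3b^3+11a^2b+9a^3b+3a^4b+11ab^2\\&+33a^3b^2+8a^4b^2+9ab^3+33a^2b^3+3a^4b^3+3ab^4+8a^2b^4+3a^3b^4.\end{aligned}$$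 Moreover $K_P(x,y)\to\frac34$ as $x\to\infty$ and $y\to\infty$. 4. $(\mathcal M^1,d_P)$ is incomplete. The diagonal points $c(x)=l(x,x)$ lie in $\mathcal M^1$ for $0<x<\log 3$, the path $c$ leaves every compact subset of $\mathcal M^1$ as $x\to0^+$, and $\int_0^1\|\dot c(x)\|_P\,dx<\infty$. -/

import Mathlib

open Filter Set MeasureTheory
open scoped Topology ENNReal

noncomputable section

/-! ## Finite metric graphs and their entropy -/

/-- A finite undirected multigraph with vertices `V` and edges numbered by `Fin k`. Each edge is
given a reference orientation, from `src` to `tgt`; loops and multiple edges are allowed. -/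
structure FiniteGraph (V : Type*) (k : ℕ) where
  src : Fin k → V
  tgt : Fin k → V

namespace FiniteGraph

variable {V : Type*} {k : ℕ}

/-- A directed edge is `(e, true)`, the edge `e` with its reference orientation, or `(e, false)`,
the edge `e` with the opposite orientation. This is its initial vertex. -/
def init (G : FiniteGraph V k) (d : Fin k × Bool) : V := if d.2 then G.src d.1 else G.tgt d.1

/-- The terminal vertex of a directed edge. -/
def term (G : FiniteGraph V k) (d : Fin k × Bool) : V := if d.2 then G.tgt d.1 else G.src d.1

/-- `A(d, d') = 1`: the directed edge `d'` begins where `d` ends, and `d'` is not the reverse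
of `d` (no backtracking). -/
def Follows (G : FiniteGraph V k) (d d' : Fin k × Bool) : Prop :=
  G.init d' = G.term d ∧ d' ≠ (d.1, !d.2)

/-- The closed cycles `(e₀, e₁, …, eₙ, e₀)` of directed edges without backtracking
(indices are taken modulo `n + 1`) of total length less than `T`. -/
def closedCycles (G : FiniteGraph V k) (l : Fin k → ℝ) (T : ℝ) :
    Set (Σ n : ℕ, Fin (n + 1) → Fin k × Bool) :=
  {c | (∀ i, G.Follows (c.2 i) (c.2 (i + 1))) ∧ ∑ i, l (c.2 i).1 < T}

/-- The metric graph `(G, l)` has entropy `h = lim_{T → ∞} (1/T) log #{γ : l(γ) < T}`. -/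
def HasEntropy (G : FiniteGraph V k) (l : Fin k → ℝ) (h : ℝ) : Prop :=
  Tendsto (fun T : ℝ => 1 / T * Real.log ((G.closedCycles l T).ncard : ℝ)) atTop (𝓝 h)

/-- The moduli space `M¹_G` of edge lengths on `G` with entropy `1`. -/
def moduliSpace (G : FiniteGraph V k) : Set (Fin k → ℝ) :=
  {l | (∀ i, 0 < l i) ∧ G.HasEntropy l 1}

/-! ## The subshift of finite type, equilibrium states and the variance -/

/-- The one-sided subshift of finite type `Σ_A⁺`, with the topology and the Borel σ-algebra
of the product `(directed edges)^ℕ`. -/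
def shiftSpace (G : FiniteGraph V k) : Set (ℕ → Fin k × Bool) :=
  {x | ∀ n, G.Follows (x n) (x (n + 1))}

/-- The shift map. -/
def shift (G : FiniteGraph V k) (x : G.shiftSpace) : G.shiftSpace :=
  ⟨fun n => x.1 (n + 1), fun n => x.2 (n + 1)⟩

/-- A function on the edges, as a locally constant function on the shift space:
`φ(x) = φ(x₀)`. -/
def edgeFun (G : FiniteGraph V k) (φ : Fin k → ℝ) (x : G.shiftSpace) : ℝ := φ (x.1 0).1

/-- The transfer operator `(L_f w)(x) = ∑_{σ y = x} e^{f(y)} w(y)`. -/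
def transfer (G : FiniteGraph V k) (f w : G.shiftSpace → ℝ) (x : G.shiftSpace) : ℝ :=
  ∑ᶠ (y : G.shiftSpace) (_ : G.shift y = x), Real.exp (f y) * w y

/-- `m` is the equilibrium state of a potential `f` of pressure zero (leading eigenvalue `1` of
the transfer operator): `m = v μ / ∫ v dμ`, where `v` is a continuous, strictly positive
eigenfunction, `L_f v = v`, and `μ` is a probability measure with `L_f^* μ = μ`. -/
def IsEquilibriumState (G : FiniteGraph V k) (f : G.shiftSpace → ℝ)
    (m : Measure G.shiftSpace) : Prop :=
  ∃ (v : C(G.shiftSpace, ℝ)) (μ : Measure G.shiftSpace),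
    IsProbabilityMeasure μ ∧ (∀ x, 0 < v x) ∧ (∀ x, G.transfer f v x = v x) ∧
    (∀ w : C(G.shiftSpace, ℝ), ∫ x, G.transfer f w x ∂μ = ∫ x, w x ∂μ) ∧
    m = (ENNReal.ofReal (∫ x, v x ∂μ))⁻¹ • μ.withDensity (fun x => ENNReal.ofReal (v x))

/-- The equilibrium state of a potential of pressure zero. -/
def equilibriumState (G : FiniteGraph V k) (f : G.shiftSpace → ℝ) : Measure G.shiftSpace :=
  Classical.epsilon (G.IsEquilibriumState f)

/-- `(1/n) ∫ (wⁿ - n ∫ w dm)² dm`, where `wⁿ = ∑_{i < n} w ∘ σⁱ`. -/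
def varianceSeq (G : FiniteGraph V k) (w : G.shiftSpace → ℝ) (m : Measure G.shiftSpace)
    (n : ℕ) : ℝ :=
  1 / (n : ℝ) *
    ∫ x, ((∑ i ∈ Finset.range n, w (G.shift^[i] x)) - (n : ℝ) * ∫ y, w y ∂m) ^ 2 ∂m

/-- The variance `Var(w, m) = lim_n (1/n) ∫ (wⁿ - n ∫ w dm)² dm`. -/
def variance (G : FiniteGraph V k) (w : G.shiftSpace → ℝ) (m : Measure G.shiftSpace) : ℝ :=
  limUnder atTop (G.varianceSeq w m)

/-! ## The pressure metric -/

/-- The equilibrium state `m_{-l}`. -/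
def edgeState (G : FiniteGraph V k) (l : Fin k → ℝ) : Measure G.shiftSpace :=
  G.equilibriumState (fun x => -G.edgeFun l x)

/-- The tangent space at `l`: functions on the edges with `∫ φ dm_{-l} = 0`. -/
def tangentSpace (G : FiniteGraph V k) (l : Fin k → ℝ) : Set (Fin k → ℝ) :=
  {φ | ∫ x, G.edgeFun φ x ∂(G.edgeState l) = 0}

/-- The pressure metric `‖φ‖²_P = Var(φ, m_{-l})`. -/
def pressureNormSq (G : FiniteGraph V k) (l φ : Fin k → ℝ) : ℝ :=
  G.variance (G.edgeFun φ) (G.edgeState l)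

/-- The inner product obtained from `‖·‖²_P` by polarization. -/
def pressureInner (G : FiniteGraph V k) (l φ ψ : Fin k → ℝ) : ℝ :=
  (G.pressureNormSq l (φ + ψ) - G.pressureNormSq l φ - G.pressureNormSq l ψ) / 2

/-- The length `L_P(γ) = ∫₀¹ ‖γ'(t)‖_P dt` of a curve on `[0, 1]`. -/
def pressureLength (G : FiniteGraph V k) (γ : ℝ → Fin k → ℝ) : ℝ≥0∞ :=
  ∫⁻ t in Icc (0 : ℝ) 1,
    ENNReal.ofReal (Real.sqrt (G.pressureNormSq (γ t) (derivWithin γ (Icc 0 1) t)))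

/-- `γ` is a continuously differentiable curve `[0, 1] → M¹_G` from `l₁` to `l₂`. -/
def IsModuliCurve (G : FiniteGraph V k) (γ : ℝ → Fin k → ℝ) (l₁ l₂ : Fin k → ℝ) : Prop :=
  ContDiffOn ℝ 1 γ (Icc 0 1) ∧ MapsTo γ (Icc 0 1) G.moduliSpace ∧ γ 0 = l₁ ∧ γ 1 = l₂

/-- The path distance `d_P(l₁, l₂)`: the infimum of the lengths of continuously differentiable
curves in `M¹_G` from `l₁` to `l₂`. -/
def pressureDist (G : FiniteGraph V k) (l₁ l₂ : Fin k → ℝ) : ℝ≥0∞ :=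
  ⨅ (γ : ℝ → Fin k → ℝ) (_ : G.IsModuliCurve γ l₁ l₂), G.pressureLength γ

/-- `(M¹_G, d_P)` is complete: every Cauchy sequence has a limit in `M¹_G`. -/
def IsPressureComplete (G : FiniteGraph V k) : Prop :=
  ∀ u : ℕ → Fin k → ℝ, (∀ n, u n ∈ G.moduliSpace) →
    (∀ ε : ℝ≥0∞, 0 < ε → ∃ N, ∀ m ≥ N, ∀ n ≥ N, G.pressureDist (u m) (u n) < ε) →
    ∃ l ∈ G.moduliSpace, Tendsto (fun n => G.pressureDist (u n) l) atTop (𝓝 0)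

end FiniteGraph

/-! ## Gaussian curvature of a metric in two coordinates -/

/-- The partial derivative `∂ᵢ f` at `p`. -/
def partialDeriv {F : Type*} [NormedAddCommGroup F] [NormedSpace ℝ F] (i : Fin 2)
    (f : (Fin 2 → ℝ) → F) (p : Fin 2 → ℝ) : F :=
  deriv (fun t => f (Function.update p i t)) (p i)

/-- The Christoffel symbols
`Γᵏᵢⱼ = ½ ∑ₘ gᵏᵐ (∂ᵢ gⱼₘ + ∂ⱼ gᵢₘ - ∂ₘ gᵢⱼ)` of the Levi-Civita connection. -/
def christoffel (g : (Fin 2 → ℝ) → Matrix (Fin 2) (Fin 2) ℝ) (k i j : Fin 2)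
    (p : Fin 2 → ℝ) : ℝ :=
  1 / 2 * ∑ m, (g p)⁻¹ k m * (partialDeriv i (fun q => g q j m) p +
    partialDeriv j (fun q => g q i m) p - partialDeriv m (fun q => g q i j) p)

/-- The `l`-th component of the curvature tensor `R(∂ᵢ, ∂ⱼ)∂ₖ = ∇ᵢ∇ⱼ∂ₖ - ∇ⱼ∇ᵢ∂ₖ`. -/
def riemannTensor (g : (Fin 2 → ℝ) → Matrix (Fin 2) (Fin 2) ℝ) (l i j k : Fin 2)
    (p : Fin 2 → ℝ) : ℝ :=
  partialDeriv i (christoffel g l j k) p - partialDeriv j (christoffel g l i k) p +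
    ∑ m, (christoffel g m j k p * christoffel g l i m p -
      christoffel g m i k p * christoffel g l j m p)

/-- The Gaussian curvature `⟨R(∂₁, ∂₂)∂₂, ∂₁⟩ / det g`. -/
def gaussianCurvature (g : (Fin 2 → ℝ) → Matrix (Fin 2) (Fin 2) ℝ) (p : Fin 2 → ℝ) : ℝ :=
  (∑ l, g p 0 l * riemannTensor g l 0 1 1 p) / (g p).det

/-! ## The belt buckle -/

/-- The belt buckle: two vertices joined by three edges. -/
def beltBuckle : FiniteGraph (Fin 2) 3 where
  src _ := 0
  tgt _ := 1

/-- The parametrization `(x, y) ↦ (x, y, S(x, y))`,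
`S(x, y) = -log ((e^{x+y} - 1) / (e^x + e^y + 2))`. -/
def beltChart (p : Fin 2 → ℝ) : Fin 3 → ℝ :=
  ![p 0, p 1,
    -Real.log ((Real.exp (p 0 + p 1) - 1) / (Real.exp (p 0) + Real.exp (p 1) + 2))]

/-- The first fundamental form of the pressure metric in the coordinates `(x, y)`. -/
def beltMetric (p : Fin 2 → ℝ) : Matrix (Fin 2) (Fin 2) ℝ :=
  Matrix.of fun i j => beltBuckle.pressureInner (beltChart p)
    (partialDeriv i beltChart p) (partialDeriv j beltChart p)

/-- The Gaussian curvature of the pressure metric in the coordinates `(x, y)`. -/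
def beltCurvature (p : Fin 2 → ℝ) : ℝ := gaussianCurvature beltMetric p

/-- The quotient of polynomials in `a = e^x`, `b = e^y` that expresses the curvature. -/
def beltCurvatureFormula (a b : ℝ) : ℝ :=
  (5 + 6 * a + 3 * a ^ 2 + 6 * b + 3 * b ^ 2 + 3 * (a * b) + 45 * (a ^ 2 * b ^ 2)
    + 19 * (a ^ 3 * b ^ 3) + 11 * (a ^ 2 * b) + 9 * (a ^ 3 * b) + 3 * (a ^ 4 * b)
    + 11 * (a * b ^ 2) + 33 * (a ^ 3 * b ^ 2) + 8 * (a ^ 4 * b ^ 2) + 9 * (a * b ^ 3)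
    + 33 * (a ^ 2 * b ^ 3) + 3 * (a ^ 4 * b ^ 3) + 3 * (a * b ^ 4) + 8 * (a ^ 2 * b ^ 4)
    + 3 * (a ^ 3 * b ^ 4)) /
  (4 * (a + 1) ^ 2 * (b + 1) ^ 2 * (3 * (a * b) + a ^ 2 * b + a * b ^ 2 - 1))

/-- The diagonal path `c(x) = (x, x, S(x, x))`. -/
def beltDiagonal (x : ℝ) : Fin 3 → ℝ := beltChart ![x, x]

end

/-!
The transfer operator of `-l` acts on functions of the first edge by a positive matrix. A Perron
vector of eigenvalue `1` conjugates it to the transfer operator of a Markov chain on the directed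
edges, so equilibrium states are stationary Markov measures, which exist and are unique because the
transition matrix is irreducible. It also bounds the number of closed cycles of length `< T` above
and below by multiples of `e^T`, up to a factor linear in `T`, so that the entropy is `1`.

For the belt buckle the Perron vector is explicit. With `qᵢ = 1 / (1 + e^{lᵢ})` the condition
`h(l) = 1` becomes `∑ qᵢ = 1`, the tangent vectors are the `φ` with `∑ qᵢ (1 - qᵢ) φᵢ = 0`, and a
coboundary (Gordin's method) makes `φ` a martingale difference, whence
`‖φ‖² = ∑ qᵢ (1 - qᵢ) (1 - 2 qᵢ) φᵢ² / ∑ qᵢ (1 - qᵢ)`. In the coordinates `(x, y)` the metric is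
rational in `a = e^x` and `b = e^y`, and Brioschi's formula gives its curvature.

Along the diagonal `‖c'(x)‖² ≤ 1 / x`, which makes the end `x → 0⁺` have finite length. There
`q₃ (1 - q₃)` tends to `0`. This function is positive on the moduli space and Lipschitz for `d_P`,
so the diagonal has no limit in the moduli space.
-/

noncomputable section

/-! ## Markov operators on a compact space -/

section MarkovOperator

variable {X : Type*} [TopologicalSpace X] [CompactSpace X]

lemma abs_le_norm_of_positive_of_map_one {Λ : C(X, ℝ) →ₗ[ℝ] ℝ} (hpos : ∀ w, 0 ≤ w → 0 ≤ Λ w)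
    (hone : Λ 1 = 1) (w : C(X, ℝ)) : |Λ w| ≤ ‖w‖ := by
  have h1 := hpos (‖w‖ • 1 - w) fun x => by
    simpa using le_of_abs_le (w.norm_coe_le_norm x)
  have h2 := hpos (w + ‖w‖ • 1) fun x => by
    simpa [neg_le_iff_add_nonneg] using neg_le_of_abs_le (w.norm_coe_le_norm x)
  simp only [map_sub, map_add, map_smul, hone, smul_eq_mul, mul_one] at h1 h2
  exact abs_le.2 ⟨by linarith, by linarith⟩

variable [T2Space X] [MeasurableSpace X] [BorelSpace X]

lemma exists_isProbabilityMeasure_integral_eq {Λ : C(X, ℝ) →ₗ[ℝ] ℝ}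
    (hpos : ∀ w, 0 ≤ w → 0 ≤ Λ w) (hone : Λ 1 = 1) :
    ∃ μ : Measure X, IsProbabilityMeasure μ ∧ ∀ w : C(X, ℝ), ∫ x, w x ∂μ = Λ w := by
  let Λc : CompactlySupportedContinuousMap X ℝ →ₚ[ℝ] ℝ := PositiveLinearMap.mk₀
    { toFun := fun f => Λ f.toContinuousMap
      map_add' := fun f g => Λ.map_add f.toContinuousMap g.toContinuousMap
      map_smul' := fun c f => Λ.map_smul c f.toContinuousMap }
    fun f hf => hpos _ hf
  have hintegral (w : C(X, ℝ)) : ∫ x, w x ∂(RealRMK.rieszMeasure Λc) = Λ w :=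
    RealRMK.integral_rieszMeasure Λc (CompactlySupportedContinuousMap.continuousMapEquiv w)
  refine ⟨_, ⟨?_⟩, hintegral⟩
  have huniv := hintegral 1
  simp only [ContinuousMap.one_apply, integral_const, smul_eq_mul, mul_one, hone] at huniv
  exact (ENNReal.toReal_eq_one_iff _).1 huniv

lemma exists_isProbabilityMeasure_tendsto_integral {ι : Type*} (𝒰 : Ultrafilter ι)
    {Λ : ι → C(X, ℝ) →ₗ[ℝ] ℝ} (hpos : ∀ i w, 0 ≤ w → 0 ≤ Λ i w) (hone : ∀ i, Λ i 1 = 1) :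
    ∃ μ : Measure X, IsProbabilityMeasure μ ∧
      ∀ w : C(X, ℝ), Tendsto (fun i => Λ i w) 𝒰 (𝓝 (∫ x, w x ∂μ)) := by
  have hlim (w : C(X, ℝ)) : ∃ a, Tendsto (fun i => Λ i w) 𝒰 (𝓝 a) := by
    have hmem : ∀ᶠ i in (𝒰 : Filter ι), Λ i w ∈ Icc (-‖w‖) ‖w‖ := Eventually.of_forall fun i =>
      abs_le.1 (abs_le_norm_of_positive_of_map_one (hpos i) (hone i) w)
    obtain ⟨a, -, ha⟩ := isCompact_Icc.ultrafilter_le_nhds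
      (𝒰.map fun i => Λ i w) (le_principal_iff.2 hmem)
    exact ⟨a, ha⟩
  choose Λlim hΛlim using hlim
  let Λ' : C(X, ℝ) →ₗ[ℝ] ℝ :=
    { toFun := Λlim
      map_add' := fun u v => tendsto_nhds_unique (hΛlim (u + v)) <| by
        simpa only [map_add] using (hΛlim u).add (hΛlim v)
      map_smul' := fun c u => tendsto_nhds_unique (hΛlim (c • u)) <| by
        simpa only [map_smul, RingHom.id_apply] using (hΛlim u).const_smul c }
  obtain ⟨μ, hμ, hintegral⟩ := exists_isProbabilityMeasure_integral_eq (Λ := Λ')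
    (fun w hw => ge_of_tendsto' (hΛlim w) fun i => hpos i w hw)
    (tendsto_nhds_unique (hΛlim 1) (by simp only [hone, tendsto_const_nhds]))
  exact ⟨μ, hμ, fun w => hintegral w ▸ hΛlim w⟩

/-- Krylov and Bogoliubov: a limit of the averages `(1/n) ∑_{i < n} (Pⁱ w)(x)` along an
ultrafilter is an invariant functional. -/
lemma exists_isProbabilityMeasure_integral_apply_eq [Nonempty X]
    {P : C(X, ℝ) →ₗ[ℝ] C(X, ℝ)} (hpos : ∀ w, 0 ≤ w → 0 ≤ P w) (hone : P 1 = 1) :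
    ∃ μ : Measure X, IsProbabilityMeasure μ ∧
      ∀ w : C(X, ℝ), ∫ x, P w x ∂μ = ∫ x, w x ∂μ := by
  obtain ⟨x₀⟩ := ‹Nonempty X›
  let eval (n : ℕ) : C(X, ℝ) →ₗ[ℝ] ℝ :=
    (ContinuousMap.evalCLM ℝ x₀ : C(X, ℝ) →L[ℝ] ℝ).toLinearMap ∘ₗ P ^ n
  have heval (n : ℕ) (w : C(X, ℝ)) : eval n w = P^[n] w x₀ := by
    simp [eval, Module.End.pow_apply]
  have hevalpos (n : ℕ) (w : C(X, ℝ)) (hw : 0 ≤ w) : 0 ≤ eval n w := by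
    have : 0 ≤ P^[n] w := by
      induction n with
      | zero => exact hw
      | succ n ih => rw [Function.iterate_succ_apply']; exact hpos _ ih
    exact (heval n w).symm ▸ this x₀
  have hevalone (n : ℕ) : eval n 1 = 1 := by
    rw [heval, Function.iterate_fixed hone, ContinuousMap.one_apply]
  let avg (n : ℕ) : C(X, ℝ) →ₗ[ℝ] ℝ := ((n + 1 : ℕ) : ℝ)⁻¹ • ∑ i ∈ Finset.range (n + 1), eval i
  have havg (n : ℕ) (w : C(X, ℝ)) :
      avg n w = birkhoffAverage ℝ P (fun u => u x₀) (n + 1) w := by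
    simp [avg, birkhoffAverage, birkhoffSum, heval]
  obtain ⟨μ, hμ, hlim⟩ := exists_isProbabilityMeasure_tendsto_integral (hyperfilter ℕ) (Λ := avg)
    (fun n w hw => by
      simpa [avg] using mul_nonneg (by positivity) (Finset.sum_nonneg fun i _ => hevalpos i w hw))
    (fun n => by simp [avg, hevalone, inv_mul_cancel₀ (Nat.cast_add_one_ne_zero (R := ℝ) n)])
  refine ⟨μ, hμ, fun w => sub_eq_zero.1 (tendsto_nhds_unique ((hlim (P w)).sub (hlim w)) ?_)⟩
  have hbdd : Bornology.IsBounded (range fun n => P^[n] w x₀) := by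
    refine (Metric.isBounded_Icc (-‖w‖) ‖w‖).subset (range_subset_iff.2 fun n => ?_)
    exact heval n w ▸
      abs_le.1 (abs_le_norm_of_positive_of_map_one (hevalpos n) (hevalone n) w)
  have hdiff := tendsto_birkhoffAverage_apply_sub_birkhoffAverage ℝ
    (f := P) (g := fun u => u x₀) (x := w) hbdd
  simp only [havg]
  exact ((tendsto_add_atTop_iff_nat 1).2 hdiff).mono_left Nat.hyperfilter_le_atTop

end MarkovOperator

/-! ## Partial derivatives and the formula of Brioschi -/

section PartialDerivatives

lemma tendsto_update (i : Fin 2) (p : Fin 2 → ℝ) :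
    Tendsto (Function.update p i) (𝓝 (p i)) (𝓝 p) := by
  have hcont : Continuous fun t : ℝ => Function.update p i t := by fun_prop
  exact (Function.update_eq_self i p ▸ hcont.tendsto (p i) :)

/-- The derivative of `f` in the `i`-th coordinate at `p` exists and equals `f'`. -/
def HasPartialAt {F : Type*} [NormedAddCommGroup F] [NormedSpace ℝ F] (i : Fin 2)
    (f : (Fin 2 → ℝ) → F) (f' : F) (p : Fin 2 → ℝ) : Prop :=
  HasDerivAt (fun t => f (Function.update p i t)) f' (p i)

variable {F : Type*} [NormedAddCommGroup F] [NormedSpace ℝ F] {i : Fin 2} {p : Fin 2 → ℝ}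

namespace HasPartialAt

lemma partialDeriv_eq {f : (Fin 2 → ℝ) → F} {f' : F} (h : HasPartialAt i f f' p) :
    partialDeriv i f p = f' :=
  h.deriv

lemma of_hasFDerivAt {f : (Fin 2 → ℝ) → F} {f' : (Fin 2 → ℝ) →L[ℝ] F} (hf : HasFDerivAt f f' p) :
    HasPartialAt i f (f' (Pi.single i 1)) p := by
  rw [← Function.update_eq_self i p] at hf
  exact hf.comp_hasDerivAt (p i) (hasDerivAt_update p i (p i))

lemma of_differentiableAt {f : (Fin 2 → ℝ) → F} (hf : DifferentiableAt ℝ f p) :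
    HasPartialAt i f (partialDeriv i f p) p := by
  have h := of_hasFDerivAt (i := i) hf.hasFDerivAt
  rwa [h.partialDeriv_eq]

lemma congr_of_eventuallyEq {f g : (Fin 2 → ℝ) → F} {f' : F} (h : HasPartialAt i f f' p)
    (hgf : g =ᶠ[𝓝 p] f) : HasPartialAt i g f' p :=
  HasDerivAt.congr_of_eventuallyEq h ((tendsto_update i p).eventually hgf)

variable {u v : (Fin 2 → ℝ) → ℝ} {u' v' : ℝ}

lemma add (hu : HasPartialAt i u u' p) (hv : HasPartialAt i v v' p) :
    HasPartialAt i (fun q => u q + v q) (u' + v') p :=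
  HasDerivAt.fun_add hu hv

lemma mul (hu : HasPartialAt i u u' p) (hv : HasPartialAt i v v' p) :
    HasPartialAt i (fun q => u q * v q) (u' * v p + u p * v') p := by
  have h := HasDerivAt.fun_mul hu hv
  rwa [Function.update_eq_self] at h

lemma div (hu : HasPartialAt i u u' p) (hv : HasPartialAt i v v' p) (hvp : v p ≠ 0) :
    HasPartialAt i (fun q => u q / v q) ((u' * v p - u p * v') / v p ^ 2) p := by
  have h := HasDerivAt.fun_div hu hv (by rwa [Function.update_eq_self])
  rwa [Function.update_eq_self] at h

lemma pow (hu : HasPartialAt i u u' p) (n : ℕ) :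
    HasPartialAt i (fun q => u q ^ n) (n * u p ^ (n - 1) * u') p := by
  have h := HasDerivAt.fun_pow hu n
  rwa [Function.update_eq_self] at h

end HasPartialAt

lemma partialDeriv_congr {f g : (Fin 2 → ℝ) → F} (h : f =ᶠ[𝓝 p] g) :
    partialDeriv i f p = partialDeriv i g p :=
  Filter.EventuallyEq.deriv_eq ((tendsto_update i p).eventually h)

lemma contDiffAt_partialDeriv {f : (Fin 2 → ℝ) → F} (hf : ContDiffAt ℝ 2 f p) :
    ContDiffAt ℝ 1 (partialDeriv i f) p := by
  have heq : partialDeriv i f =ᶠ[𝓝 p] fun q => fderiv ℝ f q (Pi.single i 1) := by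
    filter_upwards [hf.eventually (by simp)] with q hq
    exact (HasPartialAt.of_hasFDerivAt
      (hq.differentiableAt (by simp)).hasFDerivAt).partialDeriv_eq
  exact ((hf.fderiv_right (m := 1) (by norm_num)).clm_apply contDiffAt_const).congr_of_eventuallyEq
    heq

end PartialDerivatives

section Brioschi

variable {g : (Fin 2 → ℝ) → Matrix (Fin 2) (Fin 2) ℝ} {p : Fin 2 → ℝ}

/-- The first partial derivatives of the coefficients of a metric: `∂ₖ gᵢⱼ` is
`metricDeriv g p k i j`. -/
def metricDeriv (g : (Fin 2 → ℝ) → Matrix (Fin 2) (Fin 2) ℝ) (p : Fin 2 → ℝ) (k : Fin 2) :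
    Matrix (Fin 2) (Fin 2) ℝ :=
  Matrix.of fun i j => partialDeriv k (fun q => g q i j) p

/-- The Christoffel symbols of the first kind `Γₖ,ᵢⱼ = ½ (∂ᵢ gⱼₖ + ∂ⱼ gᵢₖ - ∂ₖ gᵢⱼ)`, as a function
of the first derivatives `dg` of the metric. -/
def lowerChristoffel (dg : Fin 2 → Matrix (Fin 2) (Fin 2) ℝ) (k i j : Fin 2) : ℝ :=
  1 / 2 * (dg i j k + dg j i k - dg k i j)

/-- Brioschi's expression for `K (det g)²` as a function of the metric `g` at a point, of its first
derivatives `dg`, and of the combination `κ = ∂₀∂₁ g₀₁ - ½ ∂₁∂₁ g₀₀ - ½ ∂₀∂₀ g₁₁` of its second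
derivatives. -/
def brioschi (g : Matrix (Fin 2) (Fin 2) ℝ) (dg : Fin 2 → Matrix (Fin 2) (Fin 2) ℝ) (κ : ℝ) : ℝ :=
  κ * g.det + ∑ m, ∑ n, g.adjugate m n *
    (lowerChristoffel dg m 0 1 * lowerChristoffel dg n 0 1 -
      lowerChristoffel dg m 0 0 * lowerChristoffel dg n 1 1)

lemma christoffel_eq_sum (k i j : Fin 2) :
    christoffel g k i j p = ∑ m, (g p)⁻¹ k m * lowerChristoffel (metricDeriv g p) m i j := by
  simp only [christoffel, lowerChristoffel, metricDeriv, Matrix.of_apply, Finset.mul_sum,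
    mul_left_comm]

lemma sum_mul_christoffel (hdet : (g p).det ≠ 0) (k i j : Fin 2) :
    ∑ l, g p k l * christoffel g l i j p = lowerChristoffel (metricDeriv g p) k i j := by
  have hinv : g p * (g p)⁻¹ = 1 := Matrix.mul_nonsing_inv _ hdet.isUnit
  have h := congrFun (Matrix.mulVec_mulVec
    (fun m => lowerChristoffel (metricDeriv g p) m i j) (g p) (g p)⁻¹) k
  rw [hinv, Matrix.one_mulVec] at h
  rw [← h]
  simp only [christoffel_eq_sum]
  rfl

lemma metricDeriv_isSymm (hsymm : ∀ᶠ q in 𝓝 p, (g q).IsSymm) (k : Fin 2) :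
    (metricDeriv g p k).IsSymm :=
  Matrix.IsSymm.ext fun i j => partialDeriv_congr (hsymm.mono fun _ hq => hq.apply i j)

lemma metricDeriv_eq_add (hsymm : ∀ᶠ q in 𝓝 p, (g q).IsSymm) (k i j : Fin 2) :
    metricDeriv g p k i j = lowerChristoffel (metricDeriv g p) i k j +
      lowerChristoffel (metricDeriv g p) j k i := by
  rw [lowerChristoffel, lowerChristoffel, (metricDeriv_isSymm hsymm k).apply i j]
  ring

lemma contDiffAt_metricDeriv (hg : ∀ i j, ContDiffAt ℝ 2 (fun q => g q i j) p) (k i j : Fin 2) :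
    ContDiffAt ℝ 1 (fun q => metricDeriv g q k i j) p :=
  contDiffAt_partialDeriv (hg i j)

lemma differentiableAt_lowerChristoffel (hg : ∀ i j, ContDiffAt ℝ 2 (fun q => g q i j) p)
    (k i j : Fin 2) : DifferentiableAt ℝ (fun q => lowerChristoffel (metricDeriv g q) k i j) p := by
  have hd (k i j : Fin 2) : DifferentiableAt ℝ (fun q => metricDeriv g q k i j) p :=
    (contDiffAt_metricDeriv hg k i j).differentiableAt one_ne_zero
  exact (((hd i j k).add (hd j i k)).sub (hd k i j)).const_mul _

lemma differentiableAt_inv_apply (hg : ∀ i j, ContDiffAt ℝ 2 (fun q => g q i j) p)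
    (hdet : (g p).det ≠ 0) (k m : Fin 2) : DifferentiableAt ℝ (fun q => (g q)⁻¹ k m) p := by
  have hd (i j : Fin 2) : DifferentiableAt ℝ (fun q => g q i j) p :=
    (hg i j).differentiableAt two_ne_zero
  have hdet' : DifferentiableAt ℝ (fun q => (g q).det) p := by
    simp only [Matrix.det_fin_two]
    exact ((hd 0 0).mul (hd 1 1)).sub ((hd 0 1).mul (hd 1 0))
  have hadj : DifferentiableAt ℝ (fun q => (g q).adjugate k m) p := by
    simp only [Matrix.adjugate_fin_two]
    fin_cases k <;> fin_cases m
    exacts [hd 1 1, (hd 0 1).neg, (hd 1 0).neg, hd 0 0]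
  simp only [Matrix.inv_def, Ring.inverse_eq_inv', Matrix.smul_apply, smul_eq_mul]
  exact (hdet'.inv hdet).mul hadj

lemma differentiableAt_christoffel (hg : ∀ i j, ContDiffAt ℝ 2 (fun q => g q i j) p)
    (hdet : (g p).det ≠ 0) (k i j : Fin 2) : DifferentiableAt ℝ (christoffel g k i j) p := by
  have heq : christoffel g k i j =
      fun q => ∑ m, (g q)⁻¹ k m * lowerChristoffel (metricDeriv g q) m i j :=
    funext fun q => christoffel_eq_sum k i j
  rw [heq]
  exact DifferentiableAt.fun_sum fun m _ =>
    (differentiableAt_inv_apply hg hdet k m).mul (differentiableAt_lowerChristoffel hg m i j)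

lemma sum_mul_partialDeriv_christoffel (hg : ∀ i j, ContDiffAt ℝ 2 (fun q => g q i j) p)
    (hdet : (g p).det ≠ 0) (n i j k : Fin 2) :
    ∑ l, g p n l * partialDeriv i (christoffel g l j k) p =
      partialDeriv i (fun q => lowerChristoffel (metricDeriv g q) n j k) p -
        ∑ l, metricDeriv g p i n l * christoffel g l j k p := by
  have hd (i j : Fin 2) : DifferentiableAt ℝ (fun q => g q i j) p :=
    (hg i j).differentiableAt two_ne_zero
  have hnear : ∀ᶠ q in 𝓝 p, (g q).det ≠ 0 := by
    have hcont : ContinuousAt (fun q => (g q).det) p := by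
      simp only [Matrix.det_fin_two]
      exact (((hd 0 0).mul (hd 1 1)).sub ((hd 0 1).mul (hd 1 0))).continuousAt
    exact hcont.eventually_ne hdet
  have hlower : (fun q => lowerChristoffel (metricDeriv g q) n j k) =ᶠ[𝓝 p]
      fun q => ∑ l, g q n l * christoffel g l j k q :=
    hnear.mono fun q hq => (sum_mul_christoffel hq n j k).symm
  have hprod (l : Fin 2) := (HasPartialAt.of_differentiableAt (i := i) (hd n l)).mul
    (HasPartialAt.of_differentiableAt (differentiableAt_christoffel hg hdet l j k))
  have hsum : HasPartialAt i (fun q => ∑ l, g q n l * christoffel g l j k q) _ p :=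
    HasDerivAt.fun_sum fun l (_ : l ∈ Finset.univ) => hprod l
  rw [partialDeriv_congr hlower, hsum.partialDeriv_eq, eq_sub_iff_add_eq, ← Finset.sum_add_distrib]
  exact Finset.sum_congr rfl fun l _ => add_comm _ _

lemma sum_mul_riemannTensor (hg : ∀ i j, ContDiffAt ℝ 2 (fun q => g q i j) p)
    (hsymm : ∀ᶠ q in 𝓝 p, (g q).IsSymm) (hdet : (g p).det ≠ 0) (n i j k : Fin 2) :
    ∑ l, g p n l * riemannTensor g l i j k p =
      partialDeriv i (fun q => lowerChristoffel (metricDeriv g q) n j k) p -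
        partialDeriv j (fun q => lowerChristoffel (metricDeriv g q) n i k) p +
        ∑ m, (christoffel g m i k p * lowerChristoffel (metricDeriv g p) m j n -
          christoffel g m j k p * lowerChristoffel (metricDeriv g p) m i n) := by
  have hi := sum_mul_partialDeriv_christoffel hg hdet n i j k
  have hj := sum_mul_partialDeriv_christoffel hg hdet n j i k
  have hlower (i m : Fin 2) := sum_mul_christoffel hdet n i m
  have hi₀ := hlower i 0
  have hi₁ := hlower i 1
  have hj₀ := hlower j 0
  have hj₁ := hlower j 1
  simp only [metricDeriv_eq_add hsymm i n, metricDeriv_eq_add hsymm j n, Fin.sum_univ_two,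
    riemannTensor] at *
  linear_combination hi - hj + christoffel g 0 j k p * hi₀ + christoffel g 1 j k p * hi₁ -
    christoffel g 0 i k p * hj₀ - christoffel g 1 i k p * hj₁

lemma lowerChristoffel_comm {dg : Fin 2 → Matrix (Fin 2) (Fin 2) ℝ} (hdg : ∀ k, (dg k).IsSymm)
    (k i j : Fin 2) : lowerChristoffel dg k i j = lowerChristoffel dg k j i := by
  rw [lowerChristoffel, lowerChristoffel, (hdg k).apply i j]
  ring

lemma partialDeriv_lowerChristoffel_zero_one_one (hg : ∀ i j, ContDiffAt ℝ 2 (fun q => g q i j) p)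
    (hsymm : ∀ᶠ q in 𝓝 p, (g q).IsSymm) :
    partialDeriv 0 (fun q => lowerChristoffel (metricDeriv g q) 0 1 1) p =
      partialDeriv 0 (fun q => metricDeriv g q 1 0 1) p -
        1 / 2 * partialDeriv 0 (fun q => metricDeriv g q 0 1 1) p := by
  have hd (k i j : Fin 2) := HasPartialAt.of_differentiableAt (i := 0)
    ((contDiffAt_metricDeriv hg k i j).differentiableAt one_ne_zero)
  have heq : (fun q => lowerChristoffel (metricDeriv g q) 0 1 1) =ᶠ[𝓝 p]
      fun q => metricDeriv g q 1 0 1 - 1 / 2 * metricDeriv g q 0 1 1 := by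
    filter_upwards [eventually_eventually_nhds.2 hsymm] with q hq
    rw [lowerChristoffel, (metricDeriv_isSymm hq 1).apply 0 1]
    ring
  rw [partialDeriv_congr heq]
  exact HasPartialAt.partialDeriv_eq (HasDerivAt.sub (hd 1 0 1) (HasDerivAt.const_mul _ (hd 0 1 1)))

lemma partialDeriv_lowerChristoffel_zero_zero_one (hg : ∀ i j, ContDiffAt ℝ 2 (fun q => g q i j) p)
    (hsymm : ∀ᶠ q in 𝓝 p, (g q).IsSymm) :
    partialDeriv 1 (fun q => lowerChristoffel (metricDeriv g q) 0 0 1) p =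
      1 / 2 * partialDeriv 1 (fun q => metricDeriv g q 1 0 0) p := by
  have heq : (fun q => lowerChristoffel (metricDeriv g q) 0 0 1) =ᶠ[𝓝 p]
      fun q => 1 / 2 * metricDeriv g q 1 0 0 := by
    filter_upwards [eventually_eventually_nhds.2 hsymm] with q hq
    rw [lowerChristoffel, (metricDeriv_isSymm hq 0).apply 0 1]
    ring
  rw [partialDeriv_congr heq]
  exact HasPartialAt.partialDeriv_eq (HasDerivAt.const_mul _ (HasPartialAt.of_differentiableAt
    ((contDiffAt_metricDeriv hg 1 0 0).differentiableAt one_ne_zero)))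

lemma christoffel_eq_adjugate (k i j : Fin 2) :
    christoffel g k i j p =
      (∑ m, (g p).adjugate k m * lowerChristoffel (metricDeriv g p) m i j) / (g p).det := by
  simp only [christoffel_eq_sum, Matrix.inv_def, Ring.inverse_eq_inv', Matrix.smul_apply,
    smul_eq_mul, Finset.sum_div, inv_mul_eq_div, div_mul_eq_mul_div]

theorem gaussianCurvature_eq_brioschi (hg : ∀ i j, ContDiffAt ℝ 2 (fun q => g q i j) p)
    (hsymm : ∀ᶠ q in 𝓝 p, (g q).IsSymm) (hdet : (g p).det ≠ 0) :
    gaussianCurvature g p = brioschi (g p) (metricDeriv g p)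
      (partialDeriv 0 (fun q => metricDeriv g q 1 0 1) p -
        1 / 2 * partialDeriv 1 (fun q => metricDeriv g q 1 0 0) p -
        1 / 2 * partialDeriv 0 (fun q => metricDeriv g q 0 1 1) p) / (g p).det ^ 2 := by
  have hcomm (m : Fin 2) := lowerChristoffel_comm (metricDeriv_isSymm hsymm) m 1 0
  rw [gaussianCurvature, sum_mul_riemannTensor hg hsymm hdet,
    partialDeriv_lowerChristoffel_zero_one_one hg hsymm,
    partialDeriv_lowerChristoffel_zero_zero_one hg hsymm, brioschi]
  simp only [christoffel_eq_adjugate, hcomm, Fin.sum_univ_two]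
  have hadj : (g p).adjugate 1 0 = (g p).adjugate 0 1 := by
    have h := hsymm.self_of_nhds.apply 0 1
    simp [Matrix.adjugate_fin_two, h]
  rw [hadj]
  field_simp
  ring

end Brioschi

section ExpPolynomials

open MvPolynomial
open scoped ContDiff

variable {p : Fin 2 → ℝ} {i : Fin 2} {P M : MvPolynomial (Fin 2) ℝ}

/-- The value at `p = (x, y)` of the polynomial `P` in the variables `e^x` and `e^y`. -/
def expEval (P : MvPolynomial (Fin 2) ℝ) (p : Fin 2 → ℝ) : ℝ :=
  eval (fun i => Real.exp (p i)) P

/-- The derivation `Xᵢ ∂/∂Xᵢ` of polynomials, which under `Xᵢ = e^{xᵢ}` becomes `∂/∂xᵢ`. -/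
def eulerDeriv (i : Fin 2) (P : MvPolynomial (Fin 2) ℝ) : MvPolynomial (Fin 2) ℝ :=
  X i * pderiv i P

/-- The numerator of `∂ᵢ (P / Mⁿ)` over the denominator `Mⁿ⁺¹`, in the variables `Xᵢ = e^{xᵢ}`. -/
def quotientDerivNum (n : ℕ) (i : Fin 2) (P M : MvPolynomial (Fin 2) ℝ) :
    MvPolynomial (Fin 2) ℝ :=
  eulerDeriv i P * M - n * P * eulerDeriv i M

lemma expEval_C (c : ℝ) : expEval (C c) = fun _ => c := funext fun _ => eval_C c

lemma expEval_X (j : Fin 2) : expEval (X j) = fun q => Real.exp (q j) := funext fun _ => eval_X j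

lemma expEval_add : expEval (P + M) = fun q => expEval P q + expEval M q := funext fun _ => eval_add

lemma expEval_mul : expEval (P * M) = fun q => expEval P q * expEval M q := funext fun _ => eval_mul

lemma hasPartialAt_expEval_X (j : Fin 2) :
    HasPartialAt i (expEval (X j)) (expEval (eulerDeriv i (X j)) p) p := by
  have h := (hasDerivAt_pi.1 (hasDerivAt_update p i (p i)) j).exp
  simp only [Function.update_eq_self] at h
  have heval : expEval (eulerDeriv i (X j)) p =
      Real.exp (p j) * (Pi.single i 1 : Fin 2 → ℝ) j := by
    rcases eq_or_ne j i with rfl | hij <;> simp [expEval, eulerDeriv, *]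
  rw [heval, expEval_X]
  exact h

lemma hasPartialAt_expEval : HasPartialAt i (expEval P) (expEval (eulerDeriv i P) p) p := by
  induction P using MvPolynomial.induction_on with
  | C c =>
    rw [eulerDeriv, pderiv_C, mul_zero, ← C_0, expEval_C, expEval_C]
    exact hasDerivAt_const (p i) c
  | add P Q hP hQ =>
    rw [eulerDeriv, map_add, mul_add, expEval_add, expEval_add]
    exact hP.add hQ
  | mul_X P j hP =>
    rw [expEval_mul]
    convert hP.mul (hasPartialAt_expEval_X j) using 1
    simp only [expEval, eulerDeriv, Derivation.leibniz, smul_eq_mul, map_mul, map_add]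
    ring

lemma contDiff_expEval : ContDiff ℝ ∞ (expEval P) := by
  induction P using MvPolynomial.induction_on with
  | C c => exact expEval_C c ▸ contDiff_const
  | add P Q hP hQ => exact expEval_add (P := P) ▸ hP.add hQ
  | mul_X P j hP =>
    rw [expEval_mul, expEval_X]
    exact hP.mul (Real.contDiff_exp.comp (contDiff_apply ℝ ℝ j))

lemma hasPartialAt_expEval_div_pow (n : ℕ) (hM : expEval M p ≠ 0) :
    HasPartialAt i (fun q => expEval P q / expEval M q ^ n)
      (expEval (quotientDerivNum n i P M) p / expEval M p ^ (n + 1)) p := by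
  have hderiv := (hasPartialAt_expEval (i := i) (P := P) (p := p)).div
    ((hasPartialAt_expEval (P := M)).pow n) (pow_ne_zero n hM)
  convert hderiv using 1
  have hnum : expEval (quotientDerivNum n i P M) p = expEval (eulerDeriv i P) p * expEval M p -
      n * expEval P p * expEval (eulerDeriv i M) p := by
    simp only [quotientDerivNum, expEval, map_sub, map_mul, map_natCast]
  rw [hnum]
  rcases n with _ | n
  · simp [hM]
  · field_simp
    simp only [add_tsub_cancel_right]
    ring

end ExpPolynomials

lemma brioschi_div (g : Matrix (Fin 2) (Fin 2) ℝ) (dg : Fin 2 → Matrix (Fin 2) (Fin 2) ℝ)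
    (κ m : ℝ) : brioschi (m⁻¹ • g) (fun k => (m ^ 2)⁻¹ • dg k) (κ / m ^ 3) =
      brioschi g dg κ / m ^ 5 := by
  simp only [brioschi, lowerChristoffel, Matrix.det_smul, Matrix.adjugate_smul, Matrix.smul_apply,
    smul_eq_mul, Fin.sum_univ_two, Fintype.card_fin]
  ring

/-! ## The shift space -/

namespace FiniteGraph

variable {V : Type*} {k : ℕ} {G : FiniteGraph V k}

open scoped Classical in
/-- The directed edges that a directed edge `d` may follow. -/
def predecessors (G : FiniteGraph V k) (d : Fin k × Bool) : Finset (Fin k × Bool) :=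
  {e | G.Follows e d}

@[simp] lemma mem_predecessors {d e : Fin k × Bool} :
    e ∈ G.predecessors d ↔ G.Follows e d := by
  simp only [predecessors, Finset.mem_filter_univ]

/-- Every directed edge can be continued, without backtracking, to every directed edge: the
transition matrix is irreducible. -/
def IsIrreducible (G : FiniteGraph V k) : Prop :=
  ∀ d e, Relation.TransGen G.Follows d e

instance : CompactSpace G.shiftSpace := by
  rw [← isCompact_iff_compactSpace]
  have hclosed (n : ℕ) : IsClosed {x : ℕ → Fin k × Bool | G.Follows (x n) (x (n + 1))} := by
    have hc : Continuous fun x : ℕ → Fin k × Bool => (x n, x (n + 1)) := by fun_prop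
    exact (isClosed_discrete
      {d : (Fin k × Bool) × (Fin k × Bool) | G.Follows d.1 d.2}).preimage hc
  have : G.shiftSpace = ⋂ n, {x | G.Follows (x n) (x (n + 1))} := by
    ext; simp [shiftSpace]
  exact this ▸ (isClosed_iInter hclosed).isCompact

lemma continuous_coord (n : ℕ) : Continuous fun x : G.shiftSpace => x.1 n :=
  (continuous_apply n).comp continuous_subtype_val

lemma continuous_comp_coord {α : Type*} [TopologicalSpace α] (g : Fin k × Bool → α) (n : ℕ) :
    Continuous fun x : G.shiftSpace => g (x.1 n) :=
  continuous_of_discreteTopology.comp (continuous_coord n)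

lemma continuous_edgeFun (φ : Fin k → ℝ) : Continuous (G.edgeFun φ) :=
  continuous_comp_coord (fun d => φ d.1) 0

lemma continuous_shift : Continuous (G.shift : G.shiftSpace → G.shiftSpace) :=
  Continuous.subtype_mk (continuous_pi fun n => continuous_coord (n + 1)) _

open scoped Classical in
/-- The sequence `e x₀ x₁ …`. To be total, the operation leaves `x` unchanged if `x₀` does not
follow `e`. -/
def cons (e : Fin k × Bool) (x : G.shiftSpace) : G.shiftSpace :=
  if h : G.Follows e (x.1 0) then
    ⟨fun n => Nat.casesOn n e x.1, fun n => by cases n; exacts [h, x.2 _]⟩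
  else x

lemma cons_zero {e : Fin k × Bool} {x : G.shiftSpace} (h : G.Follows e (x.1 0)) :
    (cons e x).1 0 = e := by
  simp [cons, h]

lemma cons_succ {e : Fin k × Bool} {x : G.shiftSpace} (h : G.Follows e (x.1 0)) (n : ℕ) :
    (cons e x).1 (n + 1) = x.1 n := by
  simp [cons, h]

lemma shift_cons {e : Fin k × Bool} {x : G.shiftSpace} (h : G.Follows e (x.1 0)) :
    G.shift (cons e x) = x :=
  Subtype.ext (funext fun n => cons_succ h n)

lemma cons_shift (x : G.shiftSpace) : cons (x.1 0) (G.shift x) = x := by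
  refine Subtype.ext (funext fun n => ?_)
  cases n with
  | zero => exact cons_zero (x.2 0)
  | succ n => exact cons_succ (x.2 0) n

lemma continuous_cons (e : Fin k × Bool) :
    Continuous (cons e : G.shiftSpace → G.shiftSpace) := by
  classical
  have hc {α : Type} [TopologicalSpace α] {f g : G.shiftSpace → α} (hf : Continuous f)
      (hg : Continuous g) :
      Continuous fun x : G.shiftSpace => if G.Follows e (x.1 0) then f x else g x := by
    have hclopen : IsClopen {x : G.shiftSpace | G.Follows e (x.1 0)} :=
      (isClopen_discrete {d | G.Follows e d}).preimage (continuous_coord 0)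
    exact hf.if (fun x hx => by simp [hclopen.frontier_eq] at hx) hg
  refine continuous_induced_rng.2 (continuous_pi fun n => ?_)
  cases n with
  | zero =>
    refine (hc (continuous_const (y := e)) (continuous_coord 0)).congr fun x => ?_
    by_cases h : G.Follows e (x.1 0) <;> simp [cons, h]
  | succ n =>
    refine (hc (continuous_coord n) (continuous_coord (n + 1))).congr fun x => ?_
    by_cases h : G.Follows e (x.1 0) <;> simp [cons, h]

lemma transfer_eq_sum (f w : G.shiftSpace → ℝ) (x : G.shiftSpace) :
    G.transfer f w x =
      ∑ e ∈ G.predecessors (x.1 0), Real.exp (f (cons e x)) * w (cons e x) := by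
  classical
  have hinj : Set.InjOn (fun e => cons e x) (G.predecessors (x.1 0) : Set (Fin k × Bool)) := by
    intro d hd e he hde
    have := congrArg (fun y : G.shiftSpace => y.1 0) hde
    simpa only [cons_zero (mem_predecessors.1 hd), cons_zero (mem_predecessors.1 he)] using this
  have hpreimage : {y | G.shift y = x} = ↑((G.predecessors (x.1 0)).image fun e => cons e x) := by
    ext y
    simp only [mem_ofPred_eq, Finset.coe_image, mem_image, Finset.mem_coe, mem_predecessors]
    constructor
    · rintro rfl
      exact ⟨y.1 0, y.2 0, cons_shift y⟩
    · rintro ⟨e, he, rfl⟩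
      exact shift_cons he
  calc G.transfer f w x = ∑ᶠ y ∈ {y | G.shift y = x}, Real.exp (f y) * w y := rfl
    _ = _ := by rw [hpreimage, finsum_mem_coe_finset, Finset.sum_image hinj]

namespace IsIrreducible

lemma exists_follows_right (hG : G.IsIrreducible) (d : Fin k × Bool) : ∃ e, G.Follows d e := by
  obtain ⟨e, he, -⟩ := Relation.TransGen.head'_iff.1 (hG d d)
  exact ⟨e, he⟩

lemma nonempty_shiftSpace (hG : G.IsIrreducible) (d : Fin k × Bool) :
    Nonempty G.shiftSpace := by
  choose next hnext using hG.exists_follows_right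
  exact ⟨⟨fun n => next^[n] d, fun n => by
    simpa only [Function.iterate_succ_apply'] using hnext (next^[n] d)⟩⟩

lemma of_forall_follows {P : Fin k × Bool → Prop} (hG : G.IsIrreducible)
    (hP : ∀ d e, G.Follows d e → P e → P d) {d : Fin k × Bool} (hd : P d) (e : Fin k × Bool) :
    P e :=
  (hG e d).closed' (P := P) (hP _ _) hd

lemma dense_of_cons_mem {M : Set G.shiftSpace} (hG : G.IsIrreducible) (hne : M.Nonempty)
    (hM : ∀ x ∈ M, ∀ e, G.Follows e (x.1 0) → cons e x ∈ M) : Dense M := by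
  have hstart : ∀ e, ∃ y ∈ M, y.1 0 = e := by
    obtain ⟨x, hx⟩ := hne
    refine hG.of_forall_follows (d := x.1 0) ?_ ⟨x, hx, rfl⟩
    rintro d _ hde ⟨y, hy, rfl⟩
    exact ⟨cons d y, hM y hy d hde, cons_zero hde⟩
  have happrox : ∀ N (x : G.shiftSpace), ∃ y ∈ M, ∀ i ≤ N, y.1 i = x.1 i := by
    intro N
    induction N with
    | zero =>
      intro x
      obtain ⟨y, hy, h⟩ := hstart (x.1 0)
      exact ⟨y, hy, fun i hi => by rw [Nat.le_zero.1 hi, h]⟩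
    | succ N ih =>
      intro x
      obtain ⟨y, hy, h⟩ := ih (G.shift x)
      have h0 : G.Follows (x.1 0) (y.1 0) := h 0 N.zero_le ▸ x.2 0
      refine ⟨_, hM y hy _ h0, fun i hi => ?_⟩
      cases i with
      | zero => exact cons_zero h0
      | succ i => exact (cons_succ h0 i).trans (h i (by lia))
  intro x
  choose y hy h using fun N => happrox N x
  refine mem_closure_of_tendsto (f := y) (b := atTop) ?_ (Eventually.of_forall hy)
  rw [tendsto_subtype_rng, tendsto_pi_nhds]
  intro i
  refine tendsto_const_nhds.congr' ?_
  filter_upwards [eventually_ge_atTop i] with N hN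
  exact (h N i hN).symm

end IsIrreducible

end FiniteGraph

/-! ## Perron vectors and Markov measures -/

namespace FiniteGraph

variable {V : Type*} {k : ℕ} {G : FiniteGraph V k} {l : Fin k → ℝ} {h : Fin k × Bool → ℝ}

/-- A directed edge with the opposite direction. -/
def reverse (d : Fin k × Bool) : Fin k × Bool := (d.1, !d.2)

@[simp] lemma reverse_fst (d : Fin k × Bool) : (reverse d).1 = d.1 := rfl

@[simp] lemma reverse_reverse (d : Fin k × Bool) : reverse (reverse d) = d := by
  simp [reverse]

lemma follows_reverse_iff {d e : Fin k × Bool} :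
    G.Follows (reverse e) (reverse d) ↔ G.Follows d e := by
  obtain ⟨i, b⟩ := d
  obtain ⟨j, c⟩ := e
  cases b <;> cases c <;> simp [Follows, init, term, reverse, eq_comm]

open scoped Classical in
/-- The directed edges that may follow a directed edge `d`. -/
def successors (G : FiniteGraph V k) (d : Fin k × Bool) : Finset (Fin k × Bool) :=
  {e | G.Follows d e}

@[simp] lemma mem_successors {d e : Fin k × Bool} : e ∈ G.successors d ↔ G.Follows d e := by
  simp only [successors, Finset.mem_filter_univ]

lemma sum_successors (φ : Fin k × Bool → ℝ) (d : Fin k × Bool) :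
    ∑ e ∈ G.successors d, φ e = ∑ e ∈ G.predecessors (reverse d), φ (reverse e) := by
  refine Finset.sum_nbij' reverse reverse ?_ ?_ ?_ ?_ ?_ <;>
    simp [← follows_reverse_iff (G := G) (d := d)]

/-- A positive function on the directed edges which, viewed as a function of the first edge of a
sequence, is fixed by the transfer operator of the potential `-l`. -/
structure IsPerronVector (G : FiniteGraph V k) (l : Fin k → ℝ) (h : Fin k × Bool → ℝ) :
    Prop where
  pos : ∀ d, 0 < h d
  sum_predecessors : ∀ d, ∑ e ∈ G.predecessors d, Real.exp (-l e.1) * h e = h d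

/-- The probability of the step from `d` to a predecessor `e` in the Markov chain, running
backwards along the sequences, that is obtained from the transfer operator by conjugation
with `h`. -/
def stepProb (l : Fin k → ℝ) (h : Fin k × Bool → ℝ) (d e : Fin k × Bool) : ℝ :=
  Real.exp (-l e.1) * h e / h d

/-- A signed weight on the directed edges that is stationary for the chain `stepProb l h`. -/
def IsStationary (G : FiniteGraph V k) (l : Fin k → ℝ) (h ρ : Fin k × Bool → ℝ) : Prop :=
  ∀ e, ∑ d ∈ G.successors e, ρ d * stepProb l h d e = ρ e

/-- The stationary distribution of the chain `stepProb l h`, the law of the first edge under the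
equilibrium state of `-l`. The values of `h` at the reversed edges are, by the reversal
symmetry of the graph, a left eigenvector of the transition matrix. -/
def edgeDist (l : Fin k → ℝ) (h : Fin k × Bool → ℝ) (d : Fin k × Bool) : ℝ :=
  Real.exp (-l d.1) * h d * h (reverse d) / ∑ e, Real.exp (-l e.1) * h e * h (reverse e)

namespace IsPerronVector

lemma stepProb_pos (hh : G.IsPerronVector l h) (d e : Fin k × Bool) : 0 < stepProb l h d e :=
  div_pos (mul_pos (Real.exp_pos _) (hh.pos e)) (hh.pos d)

lemma sum_stepProb (hh : G.IsPerronVector l h) (d : Fin k × Bool) :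
    ∑ e ∈ G.predecessors d, stepProb l h d e = 1 := by
  simp only [stepProb, ← Finset.sum_div, hh.sum_predecessors, div_self (hh.pos d).ne']

lemma sum_edgeDist [Nonempty (Fin k)] (hh : G.IsPerronVector l h) : ∑ d, edgeDist l h d = 1 := by
  have hpos : 0 < ∑ e, Real.exp (-l e.1) * h e * h (reverse e) := Finset.sum_pos
    (fun e _ => mul_pos (mul_pos (Real.exp_pos _) (hh.pos _)) (hh.pos _)) Finset.univ_nonempty
  simp only [edgeDist, ← Finset.sum_div, div_self hpos.ne']

lemma edgeDist_pos (hh : G.IsPerronVector l h) (d : Fin k × Bool) : 0 < edgeDist l h d := by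
  have hpos (e : Fin k × Bool) : 0 < Real.exp (-l e.1) * h e * h (reverse e) :=
    mul_pos (mul_pos (Real.exp_pos _) (hh.pos _)) (hh.pos _)
  exact div_pos (hpos d) (Finset.sum_pos (fun e _ => hpos e) ⟨d, Finset.mem_univ d⟩)

lemma isStationary_edgeDist (hh : G.IsPerronVector l h) :
    G.IsStationary l h (edgeDist l h) := by
  intro e
  have hterm (d : Fin k × Bool) : edgeDist l h d * stepProb l h d e =
      Real.exp (-l d.1) * h (reverse d) *
        (Real.exp (-l e.1) * h e / ∑ d, Real.exp (-l d.1) * h d * h (reverse d)) := by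
    have := (hh.pos d).ne'
    simp only [edgeDist, stepProb]
    field_simp
  simp only [hterm, ← Finset.sum_mul, sum_successors, reverse_fst, reverse_reverse,
    hh.sum_predecessors]
  simp only [edgeDist]
  ring

/-- The ratio of a stationary weight to the positive one attains its maximum on a set of edges
closed under successors, hence is constant. -/
lemma eq_edgeDist (hh : G.IsPerronVector l h) (hG : G.IsIrreducible) {ρ : Fin k × Bool → ℝ}
    (hρ : G.IsStationary l h ρ) (hsum : ∑ d, ρ d = 1) : ρ = edgeDist l h := by
  have : Nonempty (Fin k × Bool) := by
    by_contra hempty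
    rw [not_nonempty_iff] at hempty
    simp at hsum
  obtain ⟨e₀, he₀⟩ := Finite.exists_max fun d => ρ d / edgeDist l h d
  set M := ρ e₀ / edgeDist l h e₀
  have hle (d : Fin k × Bool) : ρ d ≤ M * edgeDist l h d :=
    (div_le_iff₀ (hh.edgeDist_pos d)).1 (he₀ d)
  have hclosed (d e : Fin k × Bool) (hde : G.Follows e d) (he : ρ e = M * edgeDist l h e) :
      ρ d = M * edgeDist l h d := by
    by_contra hne
    have hlt : ∑ d ∈ G.successors e, ρ d * stepProb l h d e <
        ∑ d ∈ G.successors e, M * edgeDist l h d * stepProb l h d e :=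
      Finset.sum_lt_sum
        (fun d _ => mul_le_mul_of_nonneg_right (hle d) (hh.stepProb_pos d e).le)
        ⟨d, mem_successors.2 hde,
          mul_lt_mul_of_pos_right (lt_of_le_of_ne (hle d) hne) (hh.stepProb_pos d e)⟩
    simp only [mul_assoc, ← Finset.mul_sum] at hlt
    rw [hρ e, hh.isStationary_edgeDist e, he] at hlt
    exact hlt.false
  have hconst (d : Fin k × Bool) : ρ d = M * edgeDist l h d :=
    (hG e₀ d).swap.closed' (P := fun d => ρ d = M * edgeDist l h d) (hclosed _ _)
      (div_mul_cancel₀ _ (hh.edgeDist_pos e₀).ne').symm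
  have : Nonempty (Fin k) := ⟨e₀.1⟩
  have hM : M = 1 := by
    simpa only [hconst, ← Finset.mul_sum, hh.sum_edgeDist, mul_one] using hsum
  simpa only [hM, one_mul] using funext hconst

end IsPerronVector

end FiniteGraph

namespace FiniteGraph

variable {V : Type*} {k : ℕ} {G : FiniteGraph V k} {l : Fin k → ℝ} {h : Fin k × Bool → ℝ}
  {m : Measure G.shiftSpace}

/-- The Markov operator `(P w)(x) = ∑ₑ p(x₀, e) w(e x₀ x₁ …)` of the chain `stepProb l h`. -/
def markovOp (G : FiniteGraph V k) (l : Fin k → ℝ) (h : Fin k × Bool → ℝ) :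
    C(G.shiftSpace, ℝ) →ₗ[ℝ] C(G.shiftSpace, ℝ) where
  toFun w :=
    { toFun := fun x => ∑ e ∈ G.predecessors (x.1 0), stepProb l h (x.1 0) e * w (cons e x)
      continuous_toFun := by
        have hc : Continuous fun p : (Fin k × Bool) × G.shiftSpace =>
            ∑ e ∈ G.predecessors p.1, stepProb l h p.1 e * w (cons e p.2) :=
          continuous_prod_of_discrete_left.2 fun d =>
            continuous_finsetSum (G.predecessors d) fun e _ =>
              (w.continuous.comp (continuous_cons e)).const_mul (stepProb l h d e)
        exact hc.comp ((continuous_coord 0).prodMk continuous_id) }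
  map_add' u w := by
    ext x
    simp only [ContinuousMap.coe_mk, ContinuousMap.add_apply, mul_add, Finset.sum_add_distrib]
  map_smul' c w := by
    ext x
    simp only [ContinuousMap.coe_mk, ContinuousMap.smul_apply, smul_eq_mul, RingHom.id_apply,
      Finset.mul_sum, mul_left_comm]

lemma markovOp_apply (w : C(G.shiftSpace, ℝ)) (x : G.shiftSpace) :
    G.markovOp l h w x = ∑ e ∈ G.predecessors (x.1 0), stepProb l h (x.1 0) e * w (cons e x) :=
  rfl

/-- A probability measure that is invariant under the dual of the Markov operator. -/
structure IsMarkovMeasure (G : FiniteGraph V k) (l : Fin k → ℝ) (h : Fin k × Bool → ℝ)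
    (m : Measure G.shiftSpace) : Prop where
  isProbabilityMeasure : IsProbabilityMeasure m
  integral_markovOp : ∀ w, ∫ x, G.markovOp l h w x ∂m = ∫ x, w x ∂m

lemma integral_comp_coord_zero [IsFiniteMeasure m] (φ : Fin k × Bool → ℝ) :
    ∫ x, φ (x.1 0) ∂m = ∑ d, m.real {x | x.1 0 = d} * φ d := by
  have hmeas : Measurable fun x : G.shiftSpace => x.1 0 := (continuous_coord 0).measurable
  rw [← integral_map hmeas.aemeasurable (measurable_of_finite φ).aestronglyMeasurable,
    integral_fintype (by simp [Integrable.of_finite])]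
  refine Finset.sum_congr rfl fun d _ => ?_
  rw [map_measureReal_apply hmeas (measurableSet_singleton d), smul_eq_mul]
  rfl

namespace IsPerronVector

lemma markovOp_nonneg (hh : G.IsPerronVector l h) {w : C(G.shiftSpace, ℝ)} (hw : 0 ≤ w) :
    0 ≤ G.markovOp l h w :=
  fun x => Finset.sum_nonneg fun e _ =>
    mul_nonneg (hh.stepProb_pos (x.1 0) e).le (hw (cons e x))

lemma markovOp_one (hh : G.IsPerronVector l h) : G.markovOp l h 1 = 1 := by
  ext x
  simp only [markovOp_apply, ContinuousMap.one_apply, mul_one, hh.sum_stepProb]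

lemma transfer_mul (hh : G.IsPerronVector l h) (w : C(G.shiftSpace, ℝ)) (x : G.shiftSpace) :
    G.transfer (fun x => -G.edgeFun l x) (fun x => h (x.1 0) * w x) x =
      h (x.1 0) * G.markovOp l h w x := by
  rw [transfer_eq_sum, markovOp_apply, Finset.mul_sum]
  refine Finset.sum_congr rfl fun e he => ?_
  have hpos := (hh.pos (x.1 0)).ne'
  simp only [edgeFun, cons_zero (mem_predecessors.1 he), stepProb]
  field_simp

/-- An invariant function attains its maximum on a set closed under prepending edges, hence on a
dense set. -/
lemma eq_of_markovOp_eq_self (hh : G.IsPerronVector l h) (hG : G.IsIrreducible)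
    {u : C(G.shiftSpace, ℝ)} (hu : G.markovOp l h u = u) (x y : G.shiftSpace) : u x = u y := by
  obtain ⟨x₀, -, hmax⟩ := isCompact_univ.exists_isMaxOn ⟨x, mem_univ x⟩ u.continuous.continuousOn
  have hle (z : G.shiftSpace) : u z ≤ u x₀ := hmax (mem_univ z)
  have hdense : Dense {z | u z = u x₀} := by
    refine hG.dense_of_cons_mem ⟨x₀, rfl⟩ fun z hz e he => ?_
    by_contra hne
    have hlt : ∑ e ∈ G.predecessors (z.1 0), stepProb l h (z.1 0) e * u (cons e z) <
        ∑ e ∈ G.predecessors (z.1 0), stepProb l h (z.1 0) e * u x₀ :=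
      Finset.sum_lt_sum
        (fun e _ => mul_le_mul_of_nonneg_left (hle _) (hh.stepProb_pos _ e).le)
        ⟨e, mem_predecessors.2 he,
          mul_lt_mul_of_pos_left (lt_of_le_of_ne (hle _) hne) (hh.stepProb_pos _ e)⟩
    rw [← markovOp_apply, hu, ← Finset.sum_mul, hh.sum_stepProb, one_mul] at hlt
    exact hlt.ne hz
  have hconst : (u : G.shiftSpace → ℝ) = fun _ => u x₀ :=
    u.continuous.ext_on hdense continuous_const fun z hz => hz
  rw [hconst]

lemma exists_isMarkovMeasure [Nonempty G.shiftSpace] (hh : G.IsPerronVector l h) :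
    ∃ m, G.IsMarkovMeasure l h m := by
  obtain ⟨m, hm, hintegral⟩ := exists_isProbabilityMeasure_integral_apply_eq
    (fun w hw => hh.markovOp_nonneg hw) hh.markovOp_one
  exact ⟨m, hm, hintegral⟩

end IsPerronVector

namespace IsMarkovMeasure

lemma isStationary (hm : G.IsMarkovMeasure l h m) :
    G.IsStationary l h fun d => m.real {x | x.1 0 = d} := by
  classical
  have := hm.isProbabilityMeasure
  intro e
  have hinv := hm.integral_markovOp
    ⟨_, continuous_comp_coord (G := G) (fun d => if d = e then (1 : ℝ) else 0) 0⟩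
  have hop (x : G.shiftSpace) : ∑ d ∈ G.predecessors (x.1 0),
      stepProb l h (x.1 0) d * (if (cons d x).1 0 = e then 1 else 0) =
        if G.Follows e (x.1 0) then stepProb l h (x.1 0) e else 0 := by
    have hcongr : ∀ d ∈ G.predecessors (x.1 0),
        stepProb l h (x.1 0) d * (if (cons d x).1 0 = e then 1 else 0) =
          if d = e then stepProb l h (x.1 0) e else 0 := fun d hd => by
      rw [cons_zero (mem_predecessors.1 hd)]
      split_ifs with hde <;> simp [hde]
    simp only [Finset.sum_congr rfl hcongr, Finset.sum_ite_eq', mem_predecessors]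
  simp only [markovOp_apply, ContinuousMap.coe_mk, hop] at hinv
  rw [integral_comp_coord_zero fun d => if G.Follows e d then stepProb l h d e else 0,
    integral_comp_coord_zero fun d => if d = e then (1 : ℝ) else 0] at hinv
  simpa only [mul_ite, mul_zero, mul_one, Finset.sum_ite_eq', Finset.mem_univ, if_true,
    ← Finset.sum_filter, successors] using hinv

lemma integral_comp_coord_zero (hm : G.IsMarkovMeasure l h m) (hh : G.IsPerronVector l h)
    (hG : G.IsIrreducible) (φ : Fin k × Bool → ℝ) :
    ∫ x, φ (x.1 0) ∂m = ∑ d, edgeDist l h d * φ d := by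
  have := hm.isProbabilityMeasure
  have hsum : ∑ d, m.real {x | x.1 0 = d} = 1 := by
    simpa using (FiniteGraph.integral_comp_coord_zero (m := m) fun _ => 1).symm
  rw [FiniteGraph.integral_comp_coord_zero, ← hh.eq_edgeDist hG hm.isStationary hsum]

/-- The Markov operator turns a function of the first `N + 2` edges into a function of the first
`N + 1` edges, and an invariant measure does not see the difference. -/
lemma integral_eq_of_forall_le {m' : Measure G.shiftSpace} (hm : G.IsMarkovMeasure l h m)
    (hm' : G.IsMarkovMeasure l h m') (hh : G.IsPerronVector l h) (hG : G.IsIrreducible) (N : ℕ)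
    (w : C(G.shiftSpace, ℝ)) (hw : ∀ x y, (∀ i ≤ N, x.1 i = y.1 i) → w x = w y) :
    ∫ x, w x ∂m = ∫ x, w x ∂m' := by
  induction N generalizing w with
  | zero =>
    obtain ⟨φ, hφ⟩ := (Function.factorsThrough_iff (f := fun x : G.shiftSpace => x.1 0) w).1
      fun x y hxy => hw x y fun i hi => by rwa [Nat.le_zero.1 hi]
    simp only [hφ, Function.comp_apply, hm.integral_comp_coord_zero hh hG,
      hm'.integral_comp_coord_zero hh hG]
  | succ N ih =>
    rw [← hm.integral_markovOp, ← hm'.integral_markovOp]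
    refine ih _ fun x y hxy => ?_
    rw [markovOp_apply, markovOp_apply, hxy 0 N.zero_le]
    refine Finset.sum_congr rfl fun e he => ?_
    have hy := mem_predecessors.1 he
    have hx : G.Follows e (x.1 0) := hxy 0 N.zero_le ▸ hy
    congr 1
    refine hw _ _ fun i hi => ?_
    cases i with
    | zero => rw [cons_zero hx, cons_zero hy]
    | succ i => rw [cons_succ hx, cons_succ hy, hxy i (by lia)]

lemma measure_restrict_mem_eq {m' : Measure G.shiftSpace} (hm : G.IsMarkovMeasure l h m)
    (hm' : G.IsMarkovMeasure l h m') (hh : G.IsPerronVector l h) (hG : G.IsIrreducible)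
    (I : Finset ℕ) (S : Set (I → Fin k × Bool)) :
    m {x | I.restrict x.1 ∈ S} = m' {x | I.restrict x.1 ∈ S} := by
  have := hm.isProbabilityMeasure
  have := hm'.isProbabilityMeasure
  have hcont : Continuous fun x : G.shiftSpace => I.restrict x.1 :=
    (Finset.continuous_restrict I).comp continuous_subtype_val
  have hmeas : MeasurableSet {x : G.shiftSpace | I.restrict x.1 ∈ S} :=
    hcont.measurable S.toFinite.measurableSet
  have hintegral := hm.integral_eq_of_forall_le hm' hh hG (I.sup id)
    ⟨fun x => S.indicator 1 (I.restrict x.1),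
      (continuous_of_discreteTopology (f := S.indicator 1)).comp hcont⟩
    fun x y hxy => by
      have : I.restrict x.1 = I.restrict y.1 :=
        funext fun i => hxy i.1 (Finset.le_sup (f := id) i.2)
      simp only [ContinuousMap.coe_mk, this]
  have hreal (ν : Measure G.shiftSpace) :
      ∫ x, S.indicator (1 : (I → Fin k × Bool) → ℝ) (I.restrict x.1) ∂ν =
        ν.real {x | I.restrict x.1 ∈ S} :=
    integral_indicator_one hmeas
  rwa [ContinuousMap.coe_mk, hreal, hreal, measureReal_eq_measureReal_iff] at hintegral

protected lemma unique {m' : Measure G.shiftSpace} (hm : G.IsMarkovMeasure l h m)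
    (hm' : G.IsMarkovMeasure l h m') (hh : G.IsPerronVector l h) (hG : G.IsIrreducible) :
    m = m' := by
  have := hm.isProbabilityMeasure
  have := hm'.isProbabilityMeasure
  have hemb : MeasurableEmbedding (Subtype.val : G.shiftSpace → ℕ → Fin k × Bool) :=
    .subtype_coe (isCompact_iff_compactSpace.2 inferInstance).isClosed.measurableSet
  have hcyl : IsProjectiveLimit (m.map Subtype.val)
      fun I : Finset ℕ => (m'.map Subtype.val).map I.restrict := fun I => by
    ext S hS
    rw [Measure.map_apply (Finset.measurable_restrict I) hS,
      Measure.map_apply (Finset.measurable_restrict I) hS, hemb.map_apply, hemb.map_apply]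
    exact hm.measure_restrict_mem_eq hm' hh hG I S
  have : IsFiniteMeasure (m'.map Subtype.val) :=
    Measure.isFiniteMeasure_map m' _
  have hmap : m.map Subtype.val = m'.map Subtype.val := hcyl.unique fun I => rfl
  rw [← hemb.comap_map m, hmap, hemb.comap_map]

end IsMarkovMeasure

end FiniteGraph

lemma smul_withDensity_ofReal_eq_tilted {X : Type*} [MeasurableSpace X] {μ : Measure X}
    {v : X → ℝ} (hv : ∀ x, 0 < v x) (hmeas : Measurable v) (hintegral : 0 < ∫ x, v x ∂μ) :
    (ENNReal.ofReal (∫ x, v x ∂μ))⁻¹ • μ.withDensity (fun x => ENNReal.ofReal (v x)) =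
      μ.tilted fun x => Real.log (v x) := by
  rw [← withDensity_smul _ hmeas.ennreal_ofReal, Measure.tilted]
  congr 1
  ext x
  simp only [Real.exp_log (hv _), Pi.smul_apply, smul_eq_mul]
  rw [ENNReal.ofReal_div_of_pos hintegral, ENNReal.div_eq_inv_mul]

lemma integrable_of_continuous {X : Type*} [TopologicalSpace X] [CompactSpace X]
    [MeasurableSpace X] [OpensMeasurableSpace X] {μ : Measure X} [IsFiniteMeasure μ] {w : X → ℝ}
    (hw : Continuous w) : Integrable w μ :=
  hw.integrable_of_hasCompactSupport (HasCompactSupport.of_compactSpace w)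

lemma integral_pos_of_continuous {X : Type*} [TopologicalSpace X] [CompactSpace X]
    [MeasurableSpace X] [OpensMeasurableSpace X] {μ : Measure X} [IsProbabilityMeasure μ]
    {w : X → ℝ} (hw : Continuous w) (hpos : ∀ x, 0 < w x) : 0 < ∫ x, w x ∂μ := by
  rw [integral_pos_iff_support_of_nonneg (fun x => (hpos x).le) (integrable_of_continuous hw),
    Function.support_eq_univ fun x => (hpos x).ne', measure_univ]
  exact one_pos

namespace FiniteGraph

variable {V : Type*} {k : ℕ} {G : FiniteGraph V k} {l : Fin k → ℝ} {h : Fin k × Bool → ℝ}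
  {m : Measure G.shiftSpace}

lemma IsMarkovMeasure.isEquilibriumState (hm : G.IsMarkovMeasure l h m)
    (hh : G.IsPerronVector l h) : G.IsEquilibriumState (fun x => -G.edgeFun l x) m := by
  have := hm.isProbabilityMeasure
  have hcont : Continuous fun x : G.shiftSpace => h (x.1 0) := continuous_comp_coord h 0
  have hlog : Continuous fun x : G.shiftSpace => -Real.log (h (x.1 0)) :=
    continuous_comp_coord (fun d => -Real.log (h d)) 0
  have hexp : Integrable (fun x : G.shiftSpace => Real.exp (-Real.log (h (x.1 0)))) m :=
    integrable_of_continuous (Real.continuous_exp.comp hlog)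
  have hprob := isProbabilityMeasure_tilted hexp
  refine ⟨⟨_, hcont⟩, m.tilted fun x => -Real.log (h (x.1 0)), hprob, fun x => hh.pos _,
    fun x => ?_, fun w => ?_, ?_⟩
  · simpa [hh.markovOp_one] using hh.transfer_mul 1 x
  · let u : C(G.shiftSpace, ℝ) :=
      ⟨_, (continuous_comp_coord (G := G) (fun d => (h d)⁻¹) 0).mul w.continuous⟩
    have hu (x : G.shiftSpace) : h (x.1 0) * u x = w x := mul_inv_cancel_left₀ (hh.pos _).ne' _
    have htransfer := fun x => hh.transfer_mul u x
    simp only [hu] at htransfer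
    have hkey (x : G.shiftSpace) (c t : ℝ) :
        (Real.exp (-Real.log (h (x.1 0))) / c) • (h (x.1 0) * t) = c⁻¹ * t := by
      have := (hh.pos (x.1 0)).ne'
      rw [Real.exp_neg, Real.exp_log (hh.pos _), smul_eq_mul]
      field_simp
    simp only [integral_tilted, htransfer, ← hu, hkey, integral_const_mul, hm.integral_markovOp]
  · simp only [ContinuousMap.coe_mk]
    rw [smul_withDensity_ofReal_eq_tilted (fun x => hh.pos _) hcont.measurable
      (integral_pos_of_continuous hcont fun x => hh.pos _), tilted_tilted hexp]
    simp [Pi.add_def]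

lemma IsEquilibriumState.isMarkovMeasure [Nonempty G.shiftSpace] (hh : G.IsPerronVector l h)
    (hG : G.IsIrreducible) (hm : G.IsEquilibriumState (fun x => -G.edgeFun l x) m) :
    G.IsMarkovMeasure l h m := by
  obtain ⟨v, μ, hμ, hvpos, hveig, hdual, rfl⟩ := hm
  let u : C(G.shiftSpace, ℝ) :=
    ⟨_, (continuous_comp_coord (G := G) (fun d => (h d)⁻¹) 0).mul v.continuous⟩
  have hu (x : G.shiftSpace) : h (x.1 0) * u x = v x := mul_inv_cancel_left₀ (hh.pos _).ne' _
  have huinv : G.markovOp l h u = u := by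
    ext x
    refine mul_left_cancel₀ (hh.pos (x.1 0)).ne' ?_
    rw [← hh.transfer_mul, funext hu, hveig, hu]
  obtain ⟨x₀⟩ := ‹Nonempty G.shiftSpace›
  have hv (x : G.shiftSpace) : v x = h (x.1 0) * u x₀ := by
    rw [← hu, hh.eq_of_markovOp_eq_self hG huinv x x₀]
  have hintegral := integral_pos_of_continuous (μ := μ) v.continuous hvpos
  have hexp : Integrable (fun x => Real.exp (Real.log (v x))) μ := by
    simpa only [Real.exp_log (hvpos _)] using integrable_of_continuous v.continuous
  rw [smul_withDensity_ofReal_eq_tilted hvpos v.continuous.measurable hintegral]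
  refine ⟨isProbabilityMeasure_tilted hexp, fun w => ?_⟩
  have hhw := hdual ⟨_, (continuous_comp_coord h 0).mul w.continuous⟩
  simp only [integral_tilted, Real.exp_log (hvpos _), smul_eq_mul]
  have hkey (x : G.shiftSpace) (c t : ℝ) : v x / c * t = u x₀ / c * (h (x.1 0) * t) := by
    rw [hv]; ring
  simp only [hkey, integral_const_mul, ← hh.transfer_mul]
  exact congrArg (u x₀ / (∫ x, v x ∂μ) * ·) hhw

namespace IsPerronVector

lemma existsUnique_isEquilibriumState [Nonempty G.shiftSpace] (hh : G.IsPerronVector l h)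
    (hG : G.IsIrreducible) :
    ∃! m, G.IsEquilibriumState (fun x => -G.edgeFun l x) m := by
  obtain ⟨m, hm⟩ := hh.exists_isMarkovMeasure
  exact ⟨m, hm.isEquilibriumState hh,
    fun m' hm' => (hm'.isMarkovMeasure hh hG).unique hm hh hG⟩

lemma isMarkovMeasure_edgeState [Nonempty G.shiftSpace] (hh : G.IsPerronVector l h)
    (hG : G.IsIrreducible) : G.IsMarkovMeasure l h (G.edgeState l) :=
  (Classical.epsilon_spec (hh.existsUnique_isEquilibriumState hG).exists).isMarkovMeasure hh hG

lemma integral_edgeFun [Nonempty G.shiftSpace] (hh : G.IsPerronVector l h)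
    (hG : G.IsIrreducible) (φ : Fin k → ℝ) :
    ∫ x, G.edgeFun φ x ∂(G.edgeState l) = ∑ d, edgeDist l h d * φ d.1 :=
  (hh.isMarkovMeasure_edgeState hG).integral_comp_coord_zero hh hG fun d => φ d.1

end IsPerronVector

end FiniteGraph

/-! ## Variances -/

lemma abs_sq_sub_sq_le {x y B ε : ℝ} (hε : 0 < ε) (hB : |y - x| ≤ B) :
    |y ^ 2 - x ^ 2| ≤ ε * x ^ 2 + (ε⁻¹ + 1) * B ^ 2 := by
  obtain ⟨z, rfl⟩ : ∃ z, y = x + z := ⟨y - x, by ring⟩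
  rw [add_sub_cancel_left] at hB
  have hz : (ε⁻¹ + 1) * z ^ 2 ≤ (ε⁻¹ + 1) * B ^ 2 := by
    have := sq_le_sq' (abs_le.1 hB).1 (abs_le.1 hB).2
    gcongr
  have hexpand (t : ℝ) : ε * (x + ε⁻¹ * t) ^ 2 = ε * x ^ 2 + 2 * (x * t) + ε⁻¹ * t ^ 2 := by
    field_simp
    ring
  have hadd : 0 ≤ ε * (x + ε⁻¹ * z) ^ 2 := by positivity
  have hsub : 0 ≤ ε * (x + ε⁻¹ * -z) ^ 2 := by positivity
  rw [hexpand] at hadd hsub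
  rw [abs_le]
  constructor <;> linarith [sq_nonneg z]

lemma tendsto_second_moment_of_bounded_perturbation {X : Type*} [MeasurableSpace X]
    {m : Measure X} [IsProbabilityMeasure m] {M S : ℕ → X → ℝ} {s B : ℝ}
    (hM : ∀ n, Integrable (fun x => M n x ^ 2) m) (hS : ∀ n, Integrable (fun x => S n x ^ 2) m)
    (hMs : ∀ n : ℕ, ∫ x, M n x ^ 2 ∂m = n * s) (hB : ∀ n x, |S n x - M n x| ≤ B) :
    Tendsto (fun n : ℕ => 1 / (n : ℝ) * ∫ x, S n x ^ 2 ∂m) atTop (𝓝 s) := by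
  have hsqrt : Tendsto (fun n : ℕ => (Real.sqrt n)⁻¹) atTop (𝓝 0) :=
    tendsto_inv_atTop_zero.comp (Real.tendsto_sqrt_atTop.comp tendsto_natCast_atTop_atTop)
  have hlim : Tendsto (fun n : ℕ => (Real.sqrt n)⁻¹ * s +
      ((Real.sqrt n)⁻¹ + (Real.sqrt n)⁻¹ ^ 2) * B ^ 2) atTop (𝓝 0) := by
    simpa using (hsqrt.mul_const s).add ((hsqrt.add (hsqrt.pow 2)).mul_const (B ^ 2))
  rw [tendsto_iff_norm_sub_tendsto_zero]
  refine squeeze_zero' (.of_forall fun n => norm_nonneg _) ?_ hlim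
  filter_upwards [eventually_gt_atTop 0] with n hn
  have hn : (0 : ℝ) < n := by exact_mod_cast hn
  set ε := (Real.sqrt n)⁻¹ with hε
  have hε0 : 0 < ε := inv_pos.2 (Real.sqrt_pos.2 hn)
  have hn2 : (n : ℝ) = (ε ^ 2)⁻¹ := by rw [hε, inv_pow, inv_inv, Real.sq_sqrt hn.le]
  have hdiff : |∫ x, S n x ^ 2 ∂m - n * s| ≤ ε * (n * s) + (ε⁻¹ + 1) * B ^ 2 := calc
    _ = |∫ x, (S n x ^ 2 - M n x ^ 2) ∂m| := by rw [integral_sub (hS n) (hM n), hMs]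
    _ ≤ ∫ x, |S n x ^ 2 - M n x ^ 2| ∂m := abs_integral_le_integral_abs
    _ ≤ ∫ x, (ε * M n x ^ 2 + (ε⁻¹ + 1) * B ^ 2) ∂m :=
      integral_mono ((hS n).sub (hM n)).abs (((hM n).const_mul ε).add (integrable_const _))
        fun x => abs_sq_sub_sq_le hε0 (hB n x)
    _ = _ := by
      rw [integral_add ((hM n).const_mul ε) (integrable_const _), integral_const_mul, hMs]
      simp
  calc ‖1 / (n : ℝ) * ∫ x, S n x ^ 2 ∂m - s‖
      = 1 / (n : ℝ) * |∫ x, S n x ^ 2 ∂m - n * s| := by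
        rw [← abs_of_pos (one_div_pos.2 hn), ← abs_mul, abs_of_pos (one_div_pos.2 hn),
          Real.norm_eq_abs]
        congr 1
        field_simp
    _ ≤ 1 / (n : ℝ) * (ε * (n * s) + (ε⁻¹ + 1) * B ^ 2) := by gcongr
    _ = ε * s + (ε + ε ^ 2) * B ^ 2 := by rw [hn2]; field_simp

lemma birkhoffSum_sub_mul_eq {X : Type*} {T : X → X} {w D u : X → ℝ} {c : ℝ}
    (hw : ∀ x, w x = D x + (u x - u (T x)) + c) (n : ℕ) (x : X) :
    birkhoffSum T w n x - n * c = birkhoffSum T D n x + (u x - u (T^[n] x)) := by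
  induction n with
  | zero => simp
  | succ n ih =>
    simp only [birkhoffSum_succ, hw, Function.iterate_succ_apply', Nat.cast_succ] at ih ⊢
    linear_combination ih

namespace FiniteGraph

variable {V : Type*} {k : ℕ} {G : FiniteGraph V k} {l : Fin k → ℝ} {h : Fin k × Bool → ℝ}
  {m : Measure G.shiftSpace}

lemma markovOp_mul_comp_shift (w u : C(G.shiftSpace, ℝ)) :
    G.markovOp l h (w * u.comp ⟨G.shift, continuous_shift⟩) = G.markovOp l h w * u := by
  ext x
  simp only [markovOp_apply, ContinuousMap.mul_apply, ContinuousMap.comp_apply,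
    ContinuousMap.coe_mk, Finset.sum_mul]
  refine Finset.sum_congr rfl fun e he => ?_
  rw [shift_cons (mem_predecessors.1 he), mul_assoc]

namespace IsMarkovMeasure

lemma integral_mul_comp_shift (hm : G.IsMarkovMeasure l h m) (w u : C(G.shiftSpace, ℝ)) :
    ∫ x, w x * u (G.shift x) ∂m = ∫ x, G.markovOp l h w x * u x ∂m := by
  have hinv := hm.integral_markovOp (w * u.comp ⟨G.shift, continuous_shift⟩)
  rw [markovOp_mul_comp_shift] at hinv
  exact hinv.symm

lemma integral_comp_shift (hm : G.IsMarkovMeasure l h m) (hh : G.IsPerronVector l h)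
    (u : C(G.shiftSpace, ℝ)) : ∫ x, u (G.shift x) ∂m = ∫ x, u x ∂m := by
  simpa [hh.markovOp_one] using hm.integral_mul_comp_shift 1 u

lemma integral_birkhoffSum_sq (hm : G.IsMarkovMeasure l h m) (hh : G.IsPerronVector l h)
    {D : C(G.shiftSpace, ℝ)} (hD : G.markovOp l h D = 0) (n : ℕ) :
    ∫ x, birkhoffSum G.shift D n x ^ 2 ∂m = n * ∫ x, D x ^ 2 ∂m := by
  have := hm.isProbabilityMeasure
  have hshift := continuous_shift (G := G)
  induction n with
  | zero => simp
  | succ n ih =>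
    have hcont : Continuous (birkhoffSum G.shift D n) :=
      continuous_finsetSum _ fun i _ => D.continuous.comp (hshift.iterate i)
    have hexpand (x : G.shiftSpace) : birkhoffSum G.shift D (n + 1) x ^ 2 =
        D x ^ 2 + (2 * (D x * birkhoffSum G.shift D n (G.shift x)) +
          birkhoffSum G.shift D n (G.shift x) ^ 2) := by
      rw [birkhoffSum_succ']
      ring
    have horth : ∫ x, D x * birkhoffSum G.shift D n (G.shift x) ∂m = 0 := by
      have := hm.integral_mul_comp_shift D ⟨_, hcont⟩
      rw [hD] at this
      simpa using this
    have hinv : ∫ x, birkhoffSum G.shift D n (G.shift x) ^ 2 ∂m =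
        ∫ x, birkhoffSum G.shift D n x ^ 2 ∂m :=
      hm.integral_comp_shift hh ⟨_, hcont.pow 2⟩
    simp only [hexpand]
    rw [integral_add (integrable_of_continuous (by fun_prop))
        (integrable_of_continuous (by fun_prop)),
      integral_add (integrable_of_continuous (by fun_prop))
        (integrable_of_continuous (by fun_prop)),
      integral_const_mul, horth, hinv, ih]
    push_cast
    ring

lemma integral_add_comp_shift_sq (hm : G.IsMarkovMeasure l h m) (hh : G.IsPerronVector l h)
    {g u : C(G.shiftSpace, ℝ)} (hgu : G.markovOp l h g = -u) :
    ∫ x, (g x + u (G.shift x)) ^ 2 ∂m = ∫ x, (g x ^ 2 - u x ^ 2) ∂m := by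
  have := hm.isProbabilityMeasure
  have hshift := continuous_shift (G := G)
  have hcross : ∫ x, g x * u (G.shift x) ∂m = -∫ x, u x ^ 2 ∂m := by
    rw [hm.integral_mul_comp_shift, hgu, ← integral_neg]
    simp [pow_two]
  have hinv : ∫ x, u (G.shift x) ^ 2 ∂m = ∫ x, u x ^ 2 ∂m :=
    hm.integral_comp_shift hh (u ^ 2)
  have hexpand (x : G.shiftSpace) : (g x + u (G.shift x)) ^ 2 =
      g x ^ 2 + (2 * (g x * u (G.shift x)) + u (G.shift x) ^ 2) := by ring
  simp only [hexpand]
  rw [integral_add (integrable_of_continuous (by fun_prop))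
      (integrable_of_continuous (by fun_prop)),
    integral_add (integrable_of_continuous (by fun_prop))
      (integrable_of_continuous (by fun_prop)),
    integral_const_mul, hcross, hinv, integral_sub (integrable_of_continuous (by fun_prop))
      (integrable_of_continuous (by fun_prop))]
  ring

/-- Gordin's method: `g + u` is cohomologous to `g + u ∘ σ`, whose translates along the shift are
orthogonal. -/
lemma tendsto_varianceSeq (hm : G.IsMarkovMeasure l h m) (hh : G.IsPerronVector l h)
    {g u : C(G.shiftSpace, ℝ)} (hgu : G.markovOp l h g = -u) {w : G.shiftSpace → ℝ} {c : ℝ}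
    (hw : ∀ x, w x = g x + u x + c) :
    Tendsto (G.varianceSeq w m) atTop (𝓝 (∫ x, (g x ^ 2 - u x ^ 2) ∂m)) := by
  have := hm.isProbabilityMeasure
  let D : C(G.shiftSpace, ℝ) := g + u.comp ⟨G.shift, continuous_shift⟩
  have hD : G.markovOp l h D = 0 := by
    have hu := markovOp_mul_comp_shift (l := l) (h := h) 1 u
    rw [one_mul, hh.markovOp_one, one_mul] at hu
    rw [map_add, hgu, hu, neg_add_cancel]
  have hmean : ∫ x, w x ∂m = c := by
    have hg := hm.integral_markovOp g
    simp only [hgu, ContinuousMap.neg_apply, integral_neg] at hg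
    simp only [hw]
    rw [integral_add (integrable_of_continuous (by fun_prop)) (integrable_const c),
      integral_add (integrable_of_continuous (by fun_prop))
        (integrable_of_continuous (by fun_prop)), ← hg]
    simp
  have hsum (n : ℕ) (x : G.shiftSpace) : birkhoffSum G.shift w n x - n * c =
      birkhoffSum G.shift D n x + (u x - u (G.shift^[n] x)) :=
    birkhoffSum_sub_mul_eq (fun y => by simp [hw, D, add_assoc, add_comm]) n x
  have hcont {v : G.shiftSpace → ℝ} (hv : Continuous v) (n : ℕ) :
      Continuous (birkhoffSum G.shift v n) :=
    continuous_finsetSum _ fun i _ => hv.comp (continuous_shift.iterate i)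
  have hwc : Continuous w := by
    rw [funext hw]
    fun_prop
  rw [← hm.integral_add_comp_shift_sq hh hgu]
  refine (tendsto_second_moment_of_bounded_perturbation
    (S := fun n x => birkhoffSum G.shift w n x - n * c) (B := ‖u‖ + ‖u‖)
    (fun n => integrable_of_continuous ((hcont D.continuous n).pow 2))
    (fun n => integrable_of_continuous (((hcont hwc n).sub continuous_const).pow 2))
    (hm.integral_birkhoffSum_sq hh hD) fun n x => ?_).congr fun n => ?_
  · rw [hsum, add_sub_cancel_left]
    exact (abs_sub _ _).trans (add_le_add (u.norm_coe_le_norm _) (u.norm_coe_le_norm _))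
  · rw [← hmean]
    rfl

end IsMarkovMeasure

end FiniteGraph

/-! ## Entropy -/

namespace FiniteGraph

variable {V : Type*} {k : ℕ} {G : FiniteGraph V k} {l : Fin k → ℝ}

/-- The edge paths from `d` that can be continued by `e`, of total length less than `T`. A path
with `n + 1` edges is encoded as in `closedCycles`. -/
def pathsBetween (G : FiniteGraph V k) (l : Fin k → ℝ) (d e : Fin k × Bool) (T : ℝ) :
    Set (Σ n : ℕ, Fin (n + 1) → Fin k × Bool) :=
  {c | c.2 0 = d ∧ (∀ i : Fin c.1, G.Follows (c.2 i.castSucc) (c.2 i.succ)) ∧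
    G.Follows (c.2 (Fin.last _)) e ∧ ∑ i, l (c.2 i).1 < T}

/-- The path `d` followed by `c`. -/
def consPath (d : Fin k × Bool) (c : Σ n : ℕ, Fin (n + 1) → Fin k × Bool) :
    Σ n : ℕ, Fin (n + 1) → Fin k × Bool :=
  ⟨c.1 + 1, Fin.cons (α := fun _ => Fin k × Bool) d c.2⟩

lemma consPath_injective (d : Fin k × Bool) : Function.Injective (consPath d) := by
  rintro ⟨n, c⟩ ⟨n', c'⟩ h
  simp only [consPath, Sigma.mk.injEq, Nat.add_right_cancel_iff] at h
  obtain ⟨rfl, h⟩ := h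
  rw [Fin.cons_right_injective (α := fun _ => Fin k × Bool) d (eq_of_heq h)]

lemma single_mem_pathsBetween {d e : Fin k × Bool} {T : ℝ} :
    ⟨0, fun _ => d⟩ ∈ G.pathsBetween l d e T ↔ G.Follows d e ∧ l d.1 < T := by
  simp [pathsBetween]

lemma consPath_mem_pathsBetween {d e : Fin k × Bool} {T : ℝ}
    {c : Σ n : ℕ, Fin (n + 1) → Fin k × Bool} :
    consPath d c ∈ G.pathsBetween l d e T ↔
      G.Follows d (c.2 0) ∧ c ∈ G.pathsBetween l (c.2 0) e (T - l d.1) := by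
  obtain ⟨n, c⟩ := c
  simp only [pathsBetween, consPath, mem_ofPred_eq, Fin.cons_zero, true_and, Fin.forall_fin_succ,
    Fin.castSucc_zero, Fin.cons_succ, Fin.sum_univ_succ (n := n + 1), ← Fin.succ_castSucc,
    ← Fin.succ_last]
  rw [and_assoc, lt_sub_iff_add_lt']

lemma biUnion_consPath_subset (d e : Fin k × Bool) (T : ℝ) :
    ⋃ a ∈ G.successors d, consPath d '' G.pathsBetween l a e (T - l d.1) ⊆
      G.pathsBetween l d e T := by
  simp only [iUnion_subset_iff, image_subset_iff]
  intro a ha c hc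
  obtain rfl := hc.1
  exact consPath_mem_pathsBetween.2 ⟨mem_successors.1 ha, hc⟩

lemma pathsBetween_subset (d e : Fin k × Bool) (T : ℝ) :
    G.pathsBetween l d e T ⊆ insert ⟨0, fun _ => d⟩
      (⋃ a ∈ G.successors d, consPath d '' G.pathsBetween l a e (T - l d.1)) := by
  rintro ⟨n, c⟩ hc
  cases n with
  | zero =>
    refine mem_insert_iff.2 (Or.inl ?_)
    congr 1
    funext i
    rw [Fin.eq_zero i]
    exact hc.1
  | succ n =>
    have hcons : (⟨n + 1, c⟩ : Σ n : ℕ, Fin (n + 1) → Fin k × Bool) =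
        consPath d ⟨n, Fin.tail c⟩ := by
      rw [consPath, ← show c 0 = d from hc.1]
      exact congrArg (Sigma.mk (n + 1)) (Fin.cons_self_tail c).symm
    rw [hcons] at hc ⊢
    obtain ⟨hfollows, htail⟩ := consPath_mem_pathsBetween.1 hc
    exact mem_insert_of_mem _
      (mem_biUnion (mem_successors.2 hfollows) (mem_image_of_mem _ htail))

lemma closedCycles_eq_iUnion (T : ℝ) :
    G.closedCycles l T = ⋃ e, G.pathsBetween l e e T := by
  ext ⟨n, c⟩
  simp only [closedCycles, mem_iUnion, pathsBetween, mem_ofPred_eq]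
  constructor
  · rintro ⟨h, hT⟩
    refine ⟨c 0, rfl, fun i => ?_, ?_, hT⟩
    · simpa only [Fin.coeSucc_eq_succ] using h i.castSucc
    · simpa only [Fin.last_add_one] using h (Fin.last n)
  · rintro ⟨e, rfl, h, hlast, hT⟩
    refine ⟨fun i => ?_, hT⟩
    induction i using Fin.lastCases with
    | last => rwa [Fin.last_add_one]
    | cast i => rw [Fin.coeSucc_eq_succ]; exact h i

lemma pathsBetween_mono (d e : Fin k × Bool) {S T : ℝ} (hST : S ≤ T) :
    G.pathsBetween l d e S ⊆ G.pathsBetween l d e T :=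
  fun _ hc => ⟨hc.1, hc.2.1, hc.2.2.1, hc.2.2.2.trans_le hST⟩

lemma pathsBetween_eq_empty (hpos : ∀ i, 0 < l i) (d e : Fin k × Bool) {T : ℝ} (hT : T ≤ 0) :
    G.pathsBetween l d e T = ∅ :=
  eq_empty_of_forall_notMem fun _ hc =>
    (hc.2.2.2.trans_le hT).not_gt (Finset.sum_pos (fun _ _ => hpos _) Finset.univ_nonempty)

lemma finite_pathsBetween {a : ℝ} (ha : 0 < a) (hal : ∀ i, a ≤ l i) (d e : Fin k × Bool) (T : ℝ) :
    (G.pathsBetween l d e T).Finite := by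
  obtain ⟨N, hN⟩ := exists_nat_ge (T / a)
  refine ((finite_lt_nat N).biUnion fun n _ =>
    finite_range (Sigma.mk (β := fun n => Fin (n + 1) → Fin k × Bool) n)).subset ?_
  rintro ⟨n, c⟩ hc
  refine mem_biUnion ?_ (mem_range_self c)
  have hlength : (n + 1) * a ≤ ∑ i, l (c i).1 := by
    simpa using Finset.card_nsmul_le_sum Finset.univ (fun i => l (c i).1) a fun i _ => hal _
  have hlt : (n + 1) * a < N * a :=
    (hlength.trans_lt hc.2.2.2).trans_le ((div_le_iff₀ ha).1 hN)
  have : (n : ℝ) + 1 < N := lt_of_mul_lt_mul_right hlt ha.le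
  have : n + 1 < N := by exact_mod_cast this
  exact (Nat.lt_succ_self n).trans this

lemma IsIrreducible.exists_pathsBetween_nonempty (hG : G.IsIrreducible) (l : Fin k → ℝ) :
    ∃ T₀, ∀ d e, (G.pathsBetween l d e T₀).Nonempty := by
  have hpath (d e : Fin k × Bool) : ∃ T, (G.pathsBetween l d e T).Nonempty := by
    induction hG d e using Relation.TransGen.head_induction_on with
    | single h => exact ⟨l _ + 1, _, single_mem_pathsBetween.2 ⟨h, lt_add_one _⟩⟩
    | @head d a hda _ ih =>
      obtain ⟨T, c, hc⟩ := ih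
      obtain rfl := hc.1
      exact ⟨T + l d.1, _, consPath_mem_pathsBetween.2 ⟨hda, by rwa [add_sub_cancel_right]⟩⟩
  choose T hT using hpath
  obtain ⟨T₀, hT₀⟩ := (Set.finite_range fun p : (Fin k × Bool) × (Fin k × Bool) =>
    T p.1 p.2).bddAbove
  exact ⟨T₀, fun d e => (hT d e).mono (pathsBetween_mono d e (hT₀ ⟨(d, e), rfl⟩))⟩

section Count

variable {a b : ℝ} {w : Fin k × Bool → ℝ}

lemma ncard_pathsBetween_le_sum (ha : 0 < a) (hal : ∀ i, a ≤ l i) (d e : Fin k × Bool) (T : ℝ) :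
    (G.pathsBetween l d e T).ncard ≤
      ∑ a ∈ G.successors d, (G.pathsBetween l a e (T - l d.1)).ncard + 1 := by
  have hfin : (⋃ a ∈ G.successors d, consPath d '' G.pathsBetween l a e (T - l d.1)).Finite :=
    (Finset.finite_toSet _).biUnion fun a _ => (finite_pathsBetween ha hal a e _).image _
  refine (ncard_le_ncard (pathsBetween_subset d e T) (hfin.insert _)).trans
    ((ncard_insert_le _ _).trans (add_le_add_left ?_ 1))
  refine (Finset.set_ncard_biUnion_le _ _).trans_eq ?_
  simp only [ncard_image_of_injective _ (consPath_injective d)]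

lemma sum_ncard_le_ncard_pathsBetween (ha : 0 < a) (hal : ∀ i, a ≤ l i) (d e : Fin k × Bool)
    (T : ℝ) :
    ∑ a ∈ G.successors d, (G.pathsBetween l a e (T - l d.1)).ncard ≤
      (G.pathsBetween l d e T).ncard := by
  have hdisj : (G.successors d : Set (Fin k × Bool)).PairwiseDisjoint
      fun a => consPath d '' G.pathsBetween l a e (T - l d.1) := fun a _ a' _ haa' =>
    (disjoint_image_iff (consPath_injective d)).2
      (Set.disjoint_left.2 fun _ hp hp' => haa' (hp.1.symm.trans hp'.1))
  have hcard := (Finset.finite_toSet (G.successors d)).ncard_biUnion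
    (fun a _ => (finite_pathsBetween ha hal a e (T - l d.1)).image (consPath d)) hdisj
  simp only [ncard_image_of_injective _ (consPath_injective d), Finset.mem_coe] at hcard
  rw [← finsum_mem_finset_eq_sum, ← hcard]
  exact ncard_le_ncard (biUnion_consPath_subset d e T) (finite_pathsBetween ha hal d e T)

lemma ncard_pathsBetween_le (ha : 0 < a) (hal : ∀ i, a ≤ l i) (hw0 : ∀ d, 0 ≤ w d)
    (hw : ∀ d, Real.exp (-l d.1) * ∑ e ∈ G.successors d, w e = w d) {K : ℝ} (hK0 : 0 ≤ K)
    (hK : ∀ d, 1 ≤ K * w d) (e : Fin k × Bool) (N : ℕ) {T : ℝ} (d : Fin k × Bool)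
    (hT : T ≤ N * a) :
    ((G.pathsBetween l d e T).ncard : ℝ) ≤ N * K * (w d * Real.exp T) := by
  induction N generalizing T d with
  | zero =>
    rw [pathsBetween_eq_empty (fun i => ha.trans_le (hal i)) d e (by simpa using hT)]
    simp
  | succ N ih =>
    rcases le_or_gt T 0 with hT0 | hT0
    · rw [pathsBetween_eq_empty (fun i => ha.trans_le (hal i)) d e hT0, ncard_empty, Nat.cast_zero]
      have := hw0 d
      positivity
    have hT' : T - l d.1 ≤ N * a := by
      push_cast at hT
      linarith [hal d.1]
    have hone : 1 ≤ K * (w d * Real.exp T) := by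
      rw [← mul_assoc]
      exact one_le_mul_of_one_le_of_one_le (hK d) (Real.one_le_exp hT0.le)
    calc ((G.pathsBetween l d e T).ncard : ℝ)
        ≤ ∑ a ∈ G.successors d, ((G.pathsBetween l a e (T - l d.1)).ncard : ℝ) + 1 := by
          exact_mod_cast ncard_pathsBetween_le_sum ha hal d e T
      _ ≤ ∑ a ∈ G.successors d, N * K * (w a * Real.exp (T - l d.1)) +
          K * (w d * Real.exp T) := by gcongr with a; exact ih a hT'
      _ = (N + 1 : ℕ) * K * (w d * Real.exp T) := by
        rw [← Finset.mul_sum, ← Finset.sum_mul, ← hw d, sub_eq_add_neg, Real.exp_add]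
        push_cast
        ring

lemma le_ncard_pathsBetween (ha : 0 < a) (hal : ∀ i, a ≤ l i) (hb : ∀ i, l i ≤ b)
    (hw : ∀ d, Real.exp (-l d.1) * ∑ e ∈ G.successors d, w e = w d) {c T₀ : ℝ}
    {e : Fin k × Bool} (hne : ∀ d, (G.pathsBetween l d e T₀).Nonempty)
    (hc : ∀ d, ∀ T ≤ T₀ + b, c * (w d * Real.exp T) ≤ 1) (N : ℕ) {T : ℝ} (d : Fin k × Bool)
    (hT₀ : T₀ ≤ T) (hT : T ≤ T₀ + b + N * a) :
    c * (w d * Real.exp T) ≤ (G.pathsBetween l d e T).ncard := by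
  have hfin (d : Fin k × Bool) (T : ℝ) := finite_pathsBetween (G := G) ha hal d e T
  have hbase {T : ℝ} (d : Fin k × Bool) (hT₀ : T₀ ≤ T) (hT : T ≤ T₀ + b) :
      c * (w d * Real.exp T) ≤ (G.pathsBetween l d e T).ncard := by
    have := (ncard_pos (hfin d T)).2 ((hne d).mono (pathsBetween_mono d e hT₀))
    exact (hc d T hT).trans (by exact_mod_cast this)
  induction N generalizing T d with
  | zero => exact hbase d hT₀ (by simpa using hT)
  | succ N ih =>
    rcases le_or_gt T (T₀ + b) with hTb | hTb
    · exact hbase d hT₀ hTb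
    have hT₀' : T₀ ≤ T - l d.1 := by linarith [hb d.1]
    have hT' : T - l d.1 ≤ T₀ + b + N * a := by
      push_cast at hT
      linarith [hal d.1]
    calc c * (w d * Real.exp T)
        = ∑ a ∈ G.successors d, c * (w a * Real.exp (T - l d.1)) := by
          rw [← Finset.mul_sum, ← Finset.sum_mul, ← hw d, sub_eq_add_neg, Real.exp_add]
          ring
      _ ≤ ∑ a ∈ G.successors d, ((G.pathsBetween l a e (T - l d.1)).ncard : ℝ) :=
        Finset.sum_le_sum fun a _ => ih a hT₀' hT'
      _ ≤ _ := by exact_mod_cast sum_ncard_le_ncard_pathsBetween ha hal d e T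

lemma IsPerronVector.sum_successors_left {h : Fin k × Bool → ℝ} (hh : G.IsPerronVector l h)
    (d : Fin k × Bool) :
    Real.exp (-l d.1) * ∑ e ∈ G.successors d, Real.exp (-l e.1) * h (reverse e) =
      Real.exp (-l d.1) * h (reverse d) := by
  simp only [sum_successors, reverse_fst, reverse_reverse, hh.sum_predecessors]

lemma exists_ncard_closedCycles_le [Nonempty (Fin k)] (hpos : ∀ i, 0 < l i)
    (hw0 : ∀ d, 0 < w d)
    (hw : ∀ d, Real.exp (-l d.1) * ∑ e ∈ G.successors d, w e = w d) :
    ∃ M, 0 < M ∧ ∀ T, 1 ≤ T → ((G.closedCycles l T).ncard : ℝ) ≤ M * T * Real.exp T := by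
  obtain ⟨a, ha, hal⟩ : ∃ a, 0 < a ∧ ∀ i, a ≤ l i :=
    (Finite.exists_min l).imp' l fun i hi => ⟨hpos i, hi⟩
  obtain ⟨K, hK0, hK⟩ : ∃ K, 0 < K ∧ ∀ d, 1 ≤ K * w d :=
    (Finite.exists_min w).imp' (fun d => (w d)⁻¹) fun d hd => ⟨inv_pos.2 (hw0 d), fun e => by
      rw [inv_mul_eq_div]
      exact (one_le_div (hw0 d)).2 (hd e)⟩
  refine ⟨(1 / a + 1) * K * ∑ e, w e + 1, ?_, fun T hT => ?_⟩
  · have := Finset.sum_nonneg fun e (_ : e ∈ Finset.univ) => (hw0 e).le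
    positivity
  have hN : (⌈T / a⌉₊ : ℝ) ≤ (1 / a + 1) * T := by
    refine (Nat.ceil_lt_add_one (by positivity)).le.trans ?_
    rw [add_mul, one_mul, div_mul_eq_mul_div, one_mul]
    linarith
  calc ((G.closedCycles l T).ncard : ℝ)
      ≤ ∑ e, ((G.pathsBetween l e e T).ncard : ℝ) := by
        rw [closedCycles_eq_iUnion]
        exact_mod_cast ncard_iUnion_le_of_fintype fun e => G.pathsBetween l e e T
    _ ≤ ∑ e, (1 / a + 1) * T * K * (w e * Real.exp T) := by
      refine Finset.sum_le_sum fun e _ => (ncard_pathsBetween_le ha hal (fun d => (hw0 d).le) hw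
        hK0.le hK e _ e ((div_le_iff₀ ha).1 (Nat.le_ceil (T / a)))).trans ?_
      have := hw0 e
      gcongr
    _ = (1 / a + 1) * K * (∑ e, w e) * T * Real.exp T := by
      rw [← Finset.mul_sum, ← Finset.sum_mul]
      ring
    _ ≤ _ := by gcongr; exact le_add_of_nonneg_right zero_le_one

lemma exists_le_ncard_closedCycles [Nonempty (Fin k)] (hG : G.IsIrreducible)
    (hpos : ∀ i, 0 < l i) (hw0 : ∀ d, 0 < w d)
    (hw : ∀ d, Real.exp (-l d.1) * ∑ e ∈ G.successors d, w e = w d) :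
    ∃ c, 0 < c ∧ ∃ T₀, ∀ T, T₀ ≤ T → c * Real.exp T ≤ (G.closedCycles l T).ncard := by
  obtain ⟨a, ha, hal⟩ : ∃ a, 0 < a ∧ ∀ i, a ≤ l i :=
    (Finite.exists_min l).imp' l fun i hi => ⟨hpos i, hi⟩
  obtain ⟨i, hb⟩ := Finite.exists_max l
  obtain ⟨d₀, hd₀⟩ := Finite.exists_max w
  obtain ⟨T₀, hne⟩ := hG.exists_pathsBetween_nonempty l
  set c := (w d₀ * Real.exp (T₀ + l i))⁻¹
  have hc0 : 0 < c := inv_pos.2 (mul_pos (hw0 d₀) (Real.exp_pos _))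
  have hc (d) (T) (hT : T ≤ T₀ + l i) : c * (w d * Real.exp T) ≤ 1 := by
    rw [inv_mul_le_one₀ (mul_pos (hw0 d₀) (Real.exp_pos _))]
    gcongr
    exacts [(hw0 d₀).le, hd₀ d]
  refine ⟨c * w d₀, mul_pos hc0 (hw0 d₀), T₀, fun T hT => ?_⟩
  have hN : T ≤ T₀ + l i + ⌈(T - (T₀ + l i)) / a⌉₊ * a := by
    linarith [(div_le_iff₀ ha).1 (Nat.le_ceil ((T - (T₀ + l i)) / a))]
  calc c * w d₀ * Real.exp T = c * (w d₀ * Real.exp T) := mul_assoc _ _ _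
    _ ≤ (G.pathsBetween l d₀ d₀ T).ncard :=
      le_ncard_pathsBetween ha hal hb hw (fun d => hne d d₀) hc _ d₀ hT hN
    _ ≤ (G.closedCycles l T).ncard := by
      rw [closedCycles_eq_iUnion]
      exact_mod_cast ncard_le_ncard (subset_iUnion (fun e => G.pathsBetween l e e T) d₀)
        (finite_iUnion fun e => finite_pathsBetween ha hal e e T)

end Count

lemma tendsto_one_div_mul_log_of_exp_bounds {f : ℝ → ℝ} {c M T₀ : ℝ} (hc : 0 < c) (hM : 0 < M)
    (hlow : ∀ T, T₀ ≤ T → c * Real.exp T ≤ f T)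
    (hup : ∀ T, 1 ≤ T → f T ≤ M * T * Real.exp T) :
    Tendsto (fun T => 1 / T * Real.log (f T)) atTop (𝓝 1) := by
  have hinv : Tendsto (fun T : ℝ => 1 / T) atTop (𝓝 0) := by
    simpa using tendsto_inv_atTop_zero (𝕜 := ℝ)
  have hlog : Tendsto (fun T : ℝ => Real.log T / T) atTop (𝓝 0) :=
    Real.isLittleO_log_id_atTop.tendsto_div_nhds_zero
  have hlowlim : Tendsto (fun T : ℝ => 1 / T * Real.log c + 1) atTop (𝓝 1) := by
    simpa using (hinv.mul_const (Real.log c)).add_const 1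
  have huplim : Tendsto (fun T : ℝ => 1 / T * Real.log M + Real.log T / T + 1) atTop (𝓝 1) := by
    simpa using ((hinv.mul_const (Real.log M)).add hlog).add_const 1
  refine tendsto_of_tendsto_of_tendsto_of_le_of_le' hlowlim huplim ?_ ?_
  · filter_upwards [eventually_ge_atTop T₀, eventually_gt_atTop 0] with T hT hT0
    have hle := Real.log_le_log (by positivity) (hlow T hT)
    rw [Real.log_mul hc.ne' (Real.exp_pos _).ne', Real.log_exp] at hle
    calc 1 / T * Real.log c + 1 = 1 / T * (Real.log c + T) := by field_simp
      _ ≤ _ := by gcongr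
  · filter_upwards [eventually_ge_atTop T₀, eventually_ge_atTop 1] with T hT hT1
    have hf : 0 < f T := lt_of_lt_of_le (by positivity) (hlow T hT)
    have hle := Real.log_le_log hf (hup T hT1)
    rw [Real.log_mul (by positivity) (Real.exp_pos _).ne', Real.log_exp,
      Real.log_mul hM.ne' (by positivity)] at hle
    calc 1 / T * Real.log (f T) ≤ 1 / T * (Real.log M + Real.log T + T) := by gcongr
      _ = _ := by field_simp

lemma IsPerronVector.hasEntropy_one [Nonempty (Fin k)] {h : Fin k × Bool → ℝ}
    (hh : G.IsPerronVector l h) (hG : G.IsIrreducible) (hpos : ∀ i, 0 < l i) :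
    G.HasEntropy l 1 := by
  have hw0 (d : Fin k × Bool) : 0 < Real.exp (-l d.1) * h (reverse d) :=
    mul_pos (Real.exp_pos _) (hh.pos _)
  obtain ⟨M, hM, hup⟩ := exists_ncard_closedCycles_le hpos hw0 hh.sum_successors_left
  obtain ⟨c, hc, T₀, hlow⟩ := exists_le_ncard_closedCycles hG hpos hw0 hh.sum_successors_left
  exact tendsto_one_div_mul_log_of_exp_bounds hc hM hlow hup

lemma hasEntropy_of_smul {t : ℝ} (ht : 0 < t) (h : G.HasEntropy (t • l) 1) :
    G.HasEntropy l t := by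
  have hcycles (T : ℝ) : G.closedCycles (t • l) (t * T) = G.closedCycles l T := by
    ext c
    simp only [closedCycles, mem_ofPred_eq, Pi.smul_apply, smul_eq_mul]
    rw [← Finset.mul_sum, mul_lt_mul_iff_right₀ ht]
  have hlim := (h.comp (tendsto_id.const_mul_atTop ht)).const_mul t
  rw [mul_one] at hlim
  refine hlim.congr fun T => ?_
  simp only [Function.comp_apply, id, hcycles]
  field_simp

end FiniteGraph

/-! ## The pressure metric of the belt buckle -/

namespace BeltBuckle

open FiniteGraph

lemma follows_iff (d e : Fin 3 × Bool) :
    beltBuckle.Follows d e ↔ e.1 ≠ d.1 ∧ e.2 = !d.2 := by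
  obtain ⟨i, b⟩ := d
  obtain ⟨j, c⟩ := e
  cases b <;> cases c <;>
    simp [FiniteGraph.Follows, FiniteGraph.init, FiniteGraph.term, beltBuckle]

instance : DecidableRel beltBuckle.Follows := fun d e => decidable_of_iff' _ (follows_iff d e)

lemma isIrreducible : beltBuckle.IsIrreducible := by
  have hshort : ∀ d e, beltBuckle.Follows d e ∨
      (∃ a, beltBuckle.Follows d a ∧ beltBuckle.Follows a e) ∨
      ∃ a b, beltBuckle.Follows d a ∧ beltBuckle.Follows a b ∧ beltBuckle.Follows b e := by
    decide
  intro d e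
  rcases hshort d e with h | ⟨a, hda, hae⟩ | ⟨a, b, hda, hab, hbe⟩
  · exact .single h
  · exact .head hda (.single hae)
  · exact .head hda (.head hab (.single hbe))

instance : Nonempty beltBuckle.shiftSpace := isIrreducible.nonempty_shiftSpace (0, true)

lemma sum_predecessors (φ : Fin 3 → ℝ) (d : Fin 3 × Bool) :
    ∑ e ∈ beltBuckle.predecessors d, φ e.1 = ∑ i, φ i - φ d.1 := by
  have hpred : beltBuckle.predecessors d = Finset.univ.erase d.1 ×ˢ {!d.2} := by
    ext e
    simp only [mem_predecessors, follows_iff, Finset.mem_product, Finset.mem_erase,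
      Finset.mem_univ, and_true, Finset.mem_singleton]
    rw [ne_comm, eq_comm, Bool.not_eq_eq_eq_not]
  rw [hpred, Finset.sum_product, ← Finset.sum_erase_eq_sub (Finset.mem_univ _)]
  simp only [Finset.sum_singleton]

variable {l φ ψ : Fin 3 → ℝ}

/-- The weight `q = 1 / (1 + e^{lᵢ})` of an edge. It satisfies `e^{-lᵢ} = q / (1 - q)`, and the
potential `-l` has pressure zero when the weights of the three edges add up to `1`. -/
def edgeProb (l : Fin 3 → ℝ) (i : Fin 3) : ℝ := 1 / (1 + Real.exp (l i))

lemma edgeProb_pos (l : Fin 3 → ℝ) (i : Fin 3) : 0 < edgeProb l i := by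
  unfold edgeProb
  positivity

lemma edgeProb_lt_one (l : Fin 3 → ℝ) (i : Fin 3) : edgeProb l i < 1 := by
  rw [edgeProb, div_lt_one (by positivity)]
  exact lt_add_of_pos_right 1 (Real.exp_pos _)

lemma one_sub_edgeProb_pos (l : Fin 3 → ℝ) (i : Fin 3) : 0 < 1 - edgeProb l i :=
  sub_pos.2 (edgeProb_lt_one l i)

lemma exp_neg_mul_one_sub_edgeProb (l : Fin 3 → ℝ) (i : Fin 3) :
    Real.exp (-l i) * (1 - edgeProb l i) = edgeProb l i := by
  rw [edgeProb, Real.exp_neg]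
  field_simp
  ring

lemma isPerronVector (hl : ∑ i, edgeProb l i = 1) :
    beltBuckle.IsPerronVector l fun d => 1 - edgeProb l d.1 where
  pos d := one_sub_edgeProb_pos l d.1
  sum_predecessors d := by
    simp only [exp_neg_mul_one_sub_edgeProb, sum_predecessors, hl]

/-- The variance `q (1 - q)` of a Bernoulli variable with parameter `q = edgeProb l i`. Up to
normalization it is the weight of the edge in the equilibrium state. -/
def edgeWeight (l : Fin 3 → ℝ) (i : Fin 3) : ℝ := edgeProb l i * (1 - edgeProb l i)

lemma edgeWeight_pos (l : Fin 3 → ℝ) (i : Fin 3) : 0 < edgeWeight l i :=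
  mul_pos (edgeProb_pos l i) (one_sub_edgeProb_pos l i)

lemma sum_edgeWeight_pos (l : Fin 3 → ℝ) : 0 < ∑ i, edgeWeight l i :=
  Finset.sum_pos (fun i _ => edgeWeight_pos l i) Finset.univ_nonempty

lemma sum_edgeDist_mul (φ : Fin 3 → ℝ) :
    ∑ d, edgeDist l (fun d => 1 - edgeProb l d.1) d * φ d.1 =
      (∑ i, edgeWeight l i * φ i) / ∑ i, edgeWeight l i := by
  have hweight (i : Fin 3) :
      Real.exp (-l i) * (1 - edgeProb l i) * (1 - edgeProb l i) = edgeWeight l i := by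
    rw [exp_neg_mul_one_sub_edgeProb, edgeWeight]
  have hdouble (f : Fin 3 → ℝ) : ∑ d : Fin 3 × Bool, f d.1 = 2 * ∑ i, f i := by
    simp only [Fintype.sum_prod_type, Fintype.sum_bool, ← two_mul, ← Finset.mul_sum]
  simp only [edgeDist, reverse_fst, hweight, div_mul_eq_mul_div, ← Finset.sum_div]
  rw [hdouble fun i => edgeWeight l i * φ i, hdouble, mul_div_mul_left _ _ two_ne_zero]

lemma existsUnique_isEquilibriumState (hl : ∑ i, edgeProb l i = 1) :
    ∃! m, beltBuckle.IsEquilibriumState (fun x => -beltBuckle.edgeFun l x) m :=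
  (isPerronVector hl).existsUnique_isEquilibriumState isIrreducible

lemma integral_edgeFun (hl : ∑ i, edgeProb l i = 1) (φ : Fin 3 → ℝ) :
    ∫ x, beltBuckle.edgeFun φ x ∂(beltBuckle.edgeState l) =
      (∑ i, edgeWeight l i * φ i) / ∑ i, edgeWeight l i := by
  rw [(isPerronVector hl).integral_edgeFun isIrreducible, sum_edgeDist_mul]

lemma mem_tangentSpace_iff (hl : ∑ i, edgeProb l i = 1) :
    φ ∈ beltBuckle.tangentSpace l ↔ ∑ i, edgeWeight l i * φ i = 0 := by
  rw [tangentSpace, mem_ofPred_eq, integral_edgeFun hl, div_eq_zero_iff,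
    or_iff_left (sum_edgeWeight_pos l).ne']

lemma markovOp_edgeFun (hφ : ∑ i, edgeWeight l i * φ i = 0) :
    beltBuckle.markovOp l (fun d => 1 - edgeProb l d.1)
      ⟨beltBuckle.edgeFun fun i => (1 - edgeProb l i) * φ i, continuous_edgeFun _⟩ =
      -⟨beltBuckle.edgeFun fun i => edgeProb l i * φ i, continuous_edgeFun _⟩ := by
  ext x
  have hne := (one_sub_edgeProb_pos l (x.1 0).1).ne'
  calc ∑ e ∈ beltBuckle.predecessors (x.1 0), stepProb l (fun d => 1 - edgeProb l d.1) (x.1 0) e *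
        beltBuckle.edgeFun (fun i => (1 - edgeProb l i) * φ i) (cons e x)
      = ∑ e ∈ beltBuckle.predecessors (x.1 0),
          edgeWeight l e.1 * φ e.1 / (1 - edgeProb l (x.1 0).1) := by
        refine Finset.sum_congr rfl fun e he => ?_
        rw [edgeFun, cons_zero (mem_predecessors.1 he), stepProb, exp_neg_mul_one_sub_edgeProb,
          edgeWeight]
        ring
    _ = (∑ i, edgeWeight l i * φ i - edgeWeight l (x.1 0).1 * φ (x.1 0).1) /
          (1 - edgeProb l (x.1 0).1) := by
        rw [sum_predecessors fun i => edgeWeight l i * φ i / (1 - edgeProb l (x.1 0).1), sub_div,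
          Finset.sum_div]
    _ = -(edgeProb l (x.1 0).1 * φ (x.1 0).1) := by
        rw [hφ, edgeWeight]
        field_simp
        ring

lemma tendsto_varianceSeq (hl : ∑ i, edgeProb l i = 1) {c : ℝ}
    (hφ : ∑ i, edgeWeight l i * φ i = 0) :
    Tendsto (beltBuckle.varianceSeq (beltBuckle.edgeFun fun i => φ i + c) (beltBuckle.edgeState l))
      atTop (𝓝 ((∑ i, edgeWeight l i * ((1 - 2 * edgeProb l i) * φ i ^ 2)) /
        ∑ i, edgeWeight l i)) := by
  have hlim := ((isPerronVector hl).isMarkovMeasure_edgeState isIrreducible).tendsto_varianceSeq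
    (isPerronVector hl) (markovOp_edgeFun hφ) (w := beltBuckle.edgeFun fun i => φ i + c) (c := c)
    fun x => by simp only [edgeFun, ContinuousMap.coe_mk]; ring
  convert hlim using 2
  rw [← integral_edgeFun hl]
  congr 1
  funext x
  simp only [edgeFun, ContinuousMap.coe_mk]
  ring

lemma tendsto_varianceSeq_pressureNormSq (hl : ∑ i, edgeProb l i = 1) (φ : Fin 3 → ℝ) :
    Tendsto (beltBuckle.varianceSeq (beltBuckle.edgeFun φ) (beltBuckle.edgeState l)) atTop
      (𝓝 (beltBuckle.pressureNormSq l φ)) := by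
  set c := (∑ i, edgeWeight l i * φ i) / ∑ i, edgeWeight l i
  have hmean : ∑ i, edgeWeight l i * (φ i - c) = 0 := by
    simp only [mul_sub, Finset.sum_sub_distrib]
    rw [← Finset.sum_mul, mul_div_cancel₀ _ (sum_edgeWeight_pos l).ne', sub_self]
  have hlim := tendsto_varianceSeq hl (c := c) hmean
  simp only [sub_add_cancel] at hlim
  exact tendsto_nhds_limUnder ⟨_, hlim⟩

lemma pressureNormSq_eq (hl : ∑ i, edgeProb l i = 1) (hφ : ∑ i, edgeWeight l i * φ i = 0) :
    beltBuckle.pressureNormSq l φ =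
      (∑ i, edgeWeight l i * ((1 - 2 * edgeProb l i) * φ i ^ 2)) / ∑ i, edgeWeight l i := by
  have hlim := tendsto_varianceSeq hl (c := 0) hφ
  simp only [add_zero] at hlim
  exact hlim.limUnder_eq

lemma pressureInner_eq (hl : ∑ i, edgeProb l i = 1) (hφ : ∑ i, edgeWeight l i * φ i = 0)
    (hψ : ∑ i, edgeWeight l i * ψ i = 0) :
    beltBuckle.pressureInner l φ ψ =
      (∑ i, edgeWeight l i * ((1 - 2 * edgeProb l i) * (φ i * ψ i))) / ∑ i, edgeWeight l i := by
  have hadd : ∑ i, edgeWeight l i * (φ + ψ) i = 0 := by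
    simp only [Pi.add_apply, mul_add, Finset.sum_add_distrib, hφ, hψ, add_zero]
  rw [pressureInner, pressureNormSq_eq hl hadd, pressureNormSq_eq hl hφ, pressureNormSq_eq hl hψ,
    ← sub_div, ← sub_div, div_right_comm, ← Finset.sum_sub_distrib, ← Finset.sum_sub_distrib,
    Finset.sum_div]
  congr 1
  refine Finset.sum_congr rfl fun i _ => ?_
  rw [Pi.add_apply]
  ring

lemma pressureNormSq_smul (hl : ∑ i, edgeProb l i = 1) (hφ : ∑ i, edgeWeight l i * φ i = 0)
    (r : ℝ) : beltBuckle.pressureNormSq l (r • φ) = r ^ 2 * beltBuckle.pressureNormSq l φ := by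
  have hr : ∑ i, edgeWeight l i * (r • φ) i = 0 := by
    simp only [Pi.smul_apply, smul_eq_mul, mul_left_comm, ← Finset.mul_sum, hφ, mul_zero]
  rw [pressureNormSq_eq hl hr, pressureNormSq_eq hl hφ, ← mul_div_assoc, Finset.mul_sum]
  congr 1
  refine Finset.sum_congr rfl fun i _ => ?_
  rw [Pi.smul_apply, smul_eq_mul]
  ring

lemma exists_scale (hpos : ∀ i, 0 < l i) : ∃ t : ℝ, 0 < t ∧ ∑ i, edgeProb (t • l) i = 1 := by
  let F (t : ℝ) : ℝ := ∑ i, edgeProb (t • l) i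
  have hcont : Continuous F := by
    refine continuous_finsetSum _ fun i _ => ?_
    simp only [edgeProb, Pi.smul_apply, smul_eq_mul]
    exact continuous_const.div (by fun_prop) fun t => by positivity
  have hzero : 1 < F 0 := by
    simp only [F, edgeProb, zero_smul, Pi.zero_apply, Real.exp_zero, Finset.sum_const]
    norm_num
  have hlim : Tendsto F atTop (𝓝 (∑ _ : Fin 3, 0)) := by
    refine tendsto_finsetSum _ fun i _ => ?_
    simp only [edgeProb, Pi.smul_apply, smul_eq_mul, one_div]
    refine tendsto_inv_atTop_zero.comp (tendsto_atTop_add_const_left _ _ ?_)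
    exact Real.tendsto_exp_atTop.comp (tendsto_id.atTop_mul_const (hpos i))
  rw [Finset.sum_const_zero] at hlim
  obtain ⟨b, hb, hb0⟩ :=
    ((hlim.eventually (gt_mem_nhds one_pos)).and (eventually_gt_atTop 0)).exists
  obtain ⟨t, ht, hFt⟩ :=
    intermediate_value_Icc' hb0.le hcont.continuousOn (mem_Icc.2 ⟨hb.le, hzero.le⟩)
  refine ⟨t, ht.1.lt_of_ne ?_, hFt⟩
  rintro rfl
  exact hzero.ne' hFt

lemma mem_moduliSpace_iff :
    l ∈ beltBuckle.moduliSpace ↔ (∀ i, 0 < l i) ∧ ∑ i, edgeProb l i = 1 := by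
  refine ⟨fun ⟨hpos, hentropy⟩ => ⟨hpos, ?_⟩, fun ⟨hpos, hl⟩ =>
    ⟨hpos, (isPerronVector hl).hasEntropy_one isIrreducible hpos⟩⟩
  obtain ⟨t, ht, hsum⟩ := exists_scale hpos
  have hentropy' : beltBuckle.HasEntropy l t := hasEntropy_of_smul ht
    ((isPerronVector hsum).hasEntropy_one isIrreducible fun i => mul_pos ht (hpos i))
  obtain rfl : 1 = t := tendsto_nhds_unique hentropy hentropy'
  rwa [one_smul] at hsum

end BeltBuckle

/-! ## The chart and the coefficients of the metric -/

namespace BeltBuckle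

/-- The coordinate domain `x, y > 0`. -/
def quadrant : Set (Fin 2 → ℝ) := {p | 0 < p 0 ∧ 0 < p 1}

lemma isOpen_quadrant : IsOpen quadrant :=
  (isOpen_lt continuous_const (continuous_apply 0)).inter
    (isOpen_lt continuous_const (continuous_apply 1))

section Chart

variable {p : Fin 2 → ℝ}

lemma one_lt_exp_zero (hp : p ∈ quadrant) : 1 < Real.exp (p 0) := Real.one_lt_exp_iff.2 hp.1

lemma one_lt_exp_one (hp : p ∈ quadrant) : 1 < Real.exp (p 1) := Real.one_lt_exp_iff.2 hp.2

lemma exp_add_sub_one_pos (hp : p ∈ quadrant) : 0 < Real.exp (p 0 + p 1) - 1 :=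
  sub_pos.2 (Real.one_lt_exp_iff.2 (add_pos hp.1 hp.2))

lemma exp_beltChart_two (hp : p ∈ quadrant) : Real.exp (beltChart p 2) =
    (Real.exp (p 0) + Real.exp (p 1) + 2) / (Real.exp (p 0 + p 1) - 1) := by
  have hpos := exp_add_sub_one_pos hp
  change Real.exp (-Real.log _) = _
  rw [Real.exp_neg, Real.exp_log (by positivity), inv_div]

lemma beltChart_two_pos_iff (hp : p ∈ quadrant) :
    0 < beltChart p 2 ↔ Real.exp (p 0 + p 1) < 3 + Real.exp (p 0) + Real.exp (p 1) := by
  rw [← Real.one_lt_exp_iff, exp_beltChart_two hp, one_lt_div (exp_add_sub_one_pos hp),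
    sub_lt_iff_lt_add]
  ring_nf

lemma edgeProb_beltChart_zero : edgeProb (beltChart p) 0 = 1 / (1 + Real.exp (p 0)) := rfl

lemma edgeProb_beltChart_one : edgeProb (beltChart p) 1 = 1 / (1 + Real.exp (p 1)) := rfl

lemma edgeProb_beltChart_two (hp : p ∈ quadrant) : edgeProb (beltChart p) 2 =
    (Real.exp (p 0) * Real.exp (p 1) - 1) / ((1 + Real.exp (p 0)) * (1 + Real.exp (p 1))) := by
  have hpos := exp_add_sub_one_pos hp
  rw [edgeProb, exp_beltChart_two hp]
  rw [Real.exp_add] at hpos ⊢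
  field_simp
  ring

lemma sum_edgeProb_beltChart (hp : p ∈ quadrant) : ∑ i, edgeProb (beltChart p) i = 1 := by
  rw [Fin.sum_univ_three, edgeProb_beltChart_zero, edgeProb_beltChart_one,
    edgeProb_beltChart_two hp]
  field_simp
  ring

lemma eq_beltChart {l : Fin 3 → ℝ} (h0 : 0 < l 0) (h1 : 0 < l 1)
    (hl : ∑ i, edgeProb l i = 1) : l = beltChart ![l 0, l 1] := by
  have hsum := (sum_edgeProb_beltChart (p := ![l 0, l 1]) ⟨h0, h1⟩).trans hl.symm
  rw [Fin.sum_univ_three, Fin.sum_univ_three] at hsum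
  have hthird : edgeProb (beltChart ![l 0, l 1]) 2 = edgeProb l 2 := add_left_cancel hsum
  simp only [edgeProb, one_div, inv_inj, add_right_inj, Real.exp_eq_exp] at hthird
  funext i
  fin_cases i
  exacts [rfl, rfl, hthird.symm]

lemma beltChart_mem_moduliSpace (hp : p ∈ quadrant)
    (hlt : Real.exp (p 0 + p 1) < 3 + Real.exp (p 0) + Real.exp (p 1)) :
    beltChart p ∈ beltBuckle.moduliSpace := by
  refine mem_moduliSpace_iff.2 ⟨fun i => ?_, sum_edgeProb_beltChart hp⟩
  fin_cases i
  exacts [hp.1, hp.2, (beltChart_two_pos_iff hp).2 hlt]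

theorem moduliSpace_eq : beltBuckle.moduliSpace = beltChart '' {p : Fin 2 → ℝ | 0 < p 0 ∧ 0 < p 1 ∧
    Real.exp (p 0 + p 1) < 3 + Real.exp (p 0) + Real.exp (p 1)} := by
  refine Subset.antisymm (fun l hl => ?_) ?_
  · obtain ⟨hpos, hsum⟩ := mem_moduliSpace_iff.1 hl
    have hchart := eq_beltChart (hpos 0) (hpos 1) hsum
    exact ⟨![l 0, l 1], ⟨hpos 0, hpos 1, (beltChart_two_pos_iff ⟨hpos 0, hpos 1⟩).1
      (hchart ▸ hpos 2)⟩, hchart.symm⟩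
  · rintro _ ⟨p, ⟨h0, h1, hlt⟩, rfl⟩
    exact beltChart_mem_moduliSpace ⟨h0, h1⟩ hlt

lemma contDiffOn_beltChart : ContDiffOn ℝ (⊤ : ℕ∞) beltChart quadrant := by
  rw [contDiffOn_pi]
  intro i
  fin_cases i
  · exact (contDiff_apply ℝ ℝ 0).contDiffOn
  · exact (contDiff_apply ℝ ℝ 1).contDiffOn
  · refine ContDiffOn.neg (ContDiffOn.log (ContDiffOn.div ?_ ?_ ?_) ?_)
    · fun_prop
    · fun_prop
    · exact fun p _ => by positivity
    · exact fun p hp => (div_pos (exp_add_sub_one_pos hp) (by positivity)).ne'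

lemma differentiableAt_beltChart (hp : p ∈ quadrant) : DifferentiableAt ℝ beltChart p :=
  (contDiffOn_beltChart.contDiffAt (isOpen_quadrant.mem_nhds hp)).differentiableAt (by simp)

end Chart

lemma hasDerivWithinAt_edgeProb {γ : ℝ → Fin 3 → ℝ} {γ' : Fin 3 → ℝ} {s : Set ℝ} {t : ℝ}
    (hγ : HasDerivWithinAt γ γ' s t) (i : Fin 3) :
    HasDerivWithinAt (fun u => edgeProb (γ u) i) (-(edgeWeight (γ t) i * γ' i)) s t := by
  have hi := hasDerivWithinAt_pi.1 hγ i
  have hq := (hi.exp.const_add 1).fun_inv (by positivity)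
  simp only [← one_div] at hq
  refine hq.congr_deriv ?_
  rw [edgeWeight, edgeProb]
  field_simp
  ring

lemma sum_edgeWeight_mul_deriv_eq_zero {γ : ℝ → Fin 3 → ℝ} {γ' : Fin 3 → ℝ} {s : Set ℝ} {t : ℝ}
    (hγ : HasDerivWithinAt γ γ' s t) (hs : UniqueDiffWithinAt ℝ s t)
    (hsum : (fun u => ∑ i, edgeProb (γ u) i) =ᶠ[𝓝[s] t] fun _ => 1)
    (ht : ∑ i, edgeProb (γ t) i = 1) : ∑ i, edgeWeight (γ t) i * γ' i = 0 := by
  have hderiv := HasDerivWithinAt.fun_sum (u := Finset.univ) fun i _ =>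
    hasDerivWithinAt_edgeProb hγ i
  have hconst := (hasDerivWithinAt_const t s (1 : ℝ)).congr_of_eventuallyEq hsum ht
  rw [← neg_eq_zero, ← Finset.sum_neg_distrib]
  exact hs.eq_deriv s hderiv hconst

section Metric

variable {p : Fin 2 → ℝ}

lemma sum_edgeWeight_mul_partialDeriv (hp : p ∈ quadrant) (i : Fin 2) :
    ∑ j, edgeWeight (beltChart p) j * partialDeriv i beltChart p j = 0 := by
  have hderiv := (HasPartialAt.of_differentiableAt (i := i)
    (differentiableAt_beltChart hp)).hasDerivWithinAt (s := univ)
  have hmem : ∀ᶠ t in 𝓝 (p i), Function.update p i t ∈ quadrant :=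
    tendsto_update i p (isOpen_quadrant.mem_nhds hp)
  have htangent := sum_edgeWeight_mul_deriv_eq_zero hderiv uniqueDiffWithinAt_univ
    (by rw [nhdsWithin_univ]; exact hmem.mono fun t ht => sum_edgeProb_beltChart ht)
    (by rw [Function.update_eq_self]; exact sum_edgeProb_beltChart hp)
  rwa [Function.update_eq_self] at htangent

lemma partialDeriv_beltChart (hp : p ∈ quadrant) (i : Fin 2) :
    partialDeriv i beltChart p = ![Pi.single (M := fun _ => ℝ) i 1 0,
      Pi.single (M := fun _ => ℝ) i 1 1,
      -(edgeWeight (beltChart p) i.castSucc / edgeWeight (beltChart p) 2)] := by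
  have hderiv := HasPartialAt.of_differentiableAt (i := i) (differentiableAt_beltChart hp)
  have hcoord := hasDerivAt_update p i (p i)
  have h0 : partialDeriv i beltChart p 0 = Pi.single (M := fun _ => ℝ) i 1 0 :=
    (hasDerivAt_pi.1 hderiv 0).unique (hasDerivAt_pi.1 hcoord 0)
  have h1 : partialDeriv i beltChart p 1 = Pi.single (M := fun _ => ℝ) i 1 1 :=
    (hasDerivAt_pi.1 hderiv 1).unique (hasDerivAt_pi.1 hcoord 1)
  have h2 : partialDeriv i beltChart p 2 =
      -(edgeWeight (beltChart p) i.castSucc / edgeWeight (beltChart p) 2) := by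
    have htangent := sum_edgeWeight_mul_partialDeriv hp i
    rw [Fin.sum_univ_three, h0, h1] at htangent
    rw [eq_neg_iff_add_eq_zero, ← mul_right_inj' (edgeWeight_pos (beltChart p) 2).ne', mul_add,
      mul_div_cancel₀ _ (edgeWeight_pos _ 2).ne', mul_zero, ← htangent]
    fin_cases i <;> simp [add_comm]
  funext j
  fin_cases j
  exacts [h0, h1, h2]

end Metric

section MetricCoefficients

variable {R : Type*} [CommRing R]

/-- The polynomial `3ab + a²b + ab² - 1`. Up to the factor `2 / ((a + 1)² (b + 1)²)` it is the total
weight of the edges at the point of the chart with `a = e^x` and `b = e^y`. -/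
def weightPoly (a b : R) : R := 3 * (a * b) + a ^ 2 * b + a * b ^ 2 - 1

/-- The common denominator of the coefficients of `beltMetric`. -/
def metricDenom (a b : R) : R := 2 * weightPoly a b * ((a * b - 1) * (a + b + 2))

/-- The numerator of the coefficient of `dx²` in `beltMetric`; that of `dy²` is obtained by
exchanging `a` and `b`. -/
def metricDiag (a b : R) : R := a * (b + 1) ^ 2 * (a ^ 2 * b + b + 2)

/-- The numerator of the coefficient of `dx dy` in `beltMetric`. -/
def metricMixed (a b : R) : R := a * b * (a + 1) * (b + 1) * (3 + a + b - a * b)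

/-- The numerators of the coefficients of `beltMetric`. -/
def metricNum (a b : R) : Matrix (Fin 2) (Fin 2) R :=
  !![metricDiag a b, metricMixed a b; metricMixed a b, metricDiag b a]

lemma det_metricNum (a b : R) : (metricNum a b).det =
    2 * (a * b) * (a + 1) ^ 2 * (b + 1) ^ 2 * (a * b - 1) ^ 2 * (a + b + 2) := by
  rw [metricNum, Matrix.det_fin_two_of, metricDiag, metricDiag, metricMixed]
  ring

end MetricCoefficients

section Positivity

variable {a b : ℝ}

lemma weightPoly_pos (ha : 1 < a) (hb : 1 < b) : 0 < weightPoly a b := by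
  have hab : 0 < a * b - 1 := sub_pos.2 (one_lt_mul_of_lt_of_le ha hb.le)
  rw [show weightPoly a b = a * b * (2 + a + b) + (a * b - 1) by rw [weightPoly]; ring]
  positivity

lemma metricDenom_pos (ha : 1 < a) (hb : 1 < b) : 0 < metricDenom a b := by
  have hab : 0 < a * b - 1 := sub_pos.2 (one_lt_mul_of_lt_of_le ha hb.le)
  have hweight := weightPoly_pos ha hb
  unfold metricDenom
  positivity

lemma det_metricNum_pos (ha : 1 < a) (hb : 1 < b) : 0 < (metricNum a b).det := by
  have hab : 0 < a * b - 1 := sub_pos.2 (one_lt_mul_of_lt_of_le ha hb.le)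
  rw [det_metricNum]
  positivity

end Positivity

section Metric

variable {p : Fin 2 → ℝ}

lemma edgeWeight_beltChart_zero :
    edgeWeight (beltChart p) 0 = Real.exp (p 0) / (1 + Real.exp (p 0)) ^ 2 := by
  rw [edgeWeight, edgeProb_beltChart_zero]
  field_simp
  ring

lemma edgeWeight_beltChart_one :
    edgeWeight (beltChart p) 1 = Real.exp (p 1) / (1 + Real.exp (p 1)) ^ 2 := by
  rw [edgeWeight, edgeProb_beltChart_one]
  field_simp
  ring

lemma edgeWeight_beltChart_two (hp : p ∈ quadrant) : edgeWeight (beltChart p) 2 =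
    (Real.exp (p 0) * Real.exp (p 1) - 1) * (Real.exp (p 0) + Real.exp (p 1) + 2) /
      ((1 + Real.exp (p 0)) * (1 + Real.exp (p 1))) ^ 2 := by
  rw [edgeWeight, edgeProb_beltChart_two hp]
  field_simp
  ring

lemma sum_edgeWeight_beltChart (hp : p ∈ quadrant) : ∑ i, edgeWeight (beltChart p) i =
    2 * weightPoly (Real.exp (p 0)) (Real.exp (p 1)) /
      ((1 + Real.exp (p 0)) * (1 + Real.exp (p 1))) ^ 2 := by
  rw [Fin.sum_univ_three, edgeWeight_beltChart_zero, edgeWeight_beltChart_one,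
    edgeWeight_beltChart_two hp, weightPoly]
  field_simp
  ring

lemma beltMetric_eq_edgeWeight (hp : p ∈ quadrant) (i j : Fin 2) : beltMetric p i j =
    ((if i = j then edgeWeight (beltChart p) i.castSucc *
        (1 - 2 * edgeProb (beltChart p) i.castSucc) else 0) +
      (1 - 2 * edgeProb (beltChart p) 2) * (edgeWeight (beltChart p) i.castSucc *
        edgeWeight (beltChart p) j.castSucc) / edgeWeight (beltChart p) 2) /
      ∑ k, edgeWeight (beltChart p) k := by
  have hthird := edgeWeight_pos (beltChart p) 2
  rw [beltMetric, Matrix.of_apply, pressureInner_eq (sum_edgeProb_beltChart hp)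
    (sum_edgeWeight_mul_partialDeriv hp i) (sum_edgeWeight_mul_partialDeriv hp j)]
  congr 1
  rw [Fin.sum_univ_three, partialDeriv_beltChart hp i, partialDeriv_beltChart hp j]
  fin_cases i <;> fin_cases j <;> simp <;> field_simp

theorem beltMetric_eq (hp : p ∈ quadrant) (i j : Fin 2) : beltMetric p i j =
    metricNum (Real.exp (p 0)) (Real.exp (p 1)) i j /
      metricDenom (Real.exp (p 0)) (Real.exp (p 1)) := by
  have hweight := weightPoly_pos (one_lt_exp_zero hp) (one_lt_exp_one hp)
  have hab : 0 < Real.exp (p 0) * Real.exp (p 1) - 1 :=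
    Real.exp_add (p 0) (p 1) ▸ exp_add_sub_one_pos hp
  have ha := Real.exp_pos (p 0)
  have hb := Real.exp_pos (p 1)
  have hq₀ := edgeProb_beltChart_zero (p := p)
  have hq₁ := edgeProb_beltChart_one (p := p)
  have hw₀ := edgeWeight_beltChart_zero (p := p)
  have hw₁ := edgeWeight_beltChart_one (p := p)
  rw [beltMetric_eq_edgeWeight hp, edgeProb_beltChart_two hp, edgeWeight_beltChart_two hp,
    sum_edgeWeight_beltChart hp, metricDenom]
  generalize Real.exp (p 0) = a at *
  generalize Real.exp (p 1) = b at *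
  have hba : 0 < b * a - 1 := mul_comm a b ▸ hab
  fin_cases i <;> fin_cases j <;>
    simp [metricNum, metricDiag, metricMixed, hq₀, hq₁, hw₀, hw₁] <;>
    field_simp <;> ring

end Metric

end BeltBuckle

/-! ## Curvature -/

namespace BeltBuckle

section Curvature

open MvPolynomial

variable {p : Fin 2 → ℝ}

/-- The numerators of the coefficients of `beltMetric`, as polynomials in `e^x` and `e^y`. -/
def metricNumPoly : Matrix (Fin 2) (Fin 2) (MvPolynomial (Fin 2) ℝ) := metricNum (X 0) (X 1)

/-- The common denominator of the coefficients of `beltMetric`, as a polynomial in `e^x` and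
`e^y`. -/
def metricDenomPoly : MvPolynomial (Fin 2) ℝ := metricDenom (X 0) (X 1)

/-- The numerators of the first derivatives `∂ₖ gᵢⱼ` of `beltMetric`. -/
def metricDerivNum (k i j : Fin 2) : MvPolynomial (Fin 2) ℝ :=
  quotientDerivNum 1 k (metricNumPoly i j) metricDenomPoly

/-- The numerators of the second derivatives `∂ₗ ∂ₖ gᵢⱼ` of `beltMetric`. -/
def metricDeriv₂Num (l k i j : Fin 2) : MvPolynomial (Fin 2) ℝ :=
  quotientDerivNum 2 l (metricDerivNum k i j) metricDenomPoly

lemma expEval_metricNumPoly (i j : Fin 2) :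
    expEval (metricNumPoly i j) p = metricNum (Real.exp (p 0)) (Real.exp (p 1)) i j := by
  fin_cases i <;> fin_cases j <;>
    simp [metricNumPoly, metricNum, metricDiag, metricMixed, expEval]

lemma expEval_metricDenomPoly :
    expEval metricDenomPoly p = metricDenom (Real.exp (p 0)) (Real.exp (p 1)) := by
  simp [metricDenomPoly, metricDenom, weightPoly, expEval]

lemma expEval_metricDenomPoly_pos (hp : p ∈ quadrant) : 0 < expEval metricDenomPoly p :=
  expEval_metricDenomPoly ▸ metricDenom_pos (one_lt_exp_zero hp) (one_lt_exp_one hp)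

lemma beltMetric_eq_expEval (hp : p ∈ quadrant) (i j : Fin 2) :
    beltMetric p i j = expEval (metricNumPoly i j) p / expEval metricDenomPoly p := by
  rw [beltMetric_eq hp, expEval_metricNumPoly, expEval_metricDenomPoly]

lemma metricDeriv_beltMetric (hp : p ∈ quadrant) (k i j : Fin 2) :
    metricDeriv beltMetric p k i j =
      expEval (metricDerivNum k i j) p / expEval metricDenomPoly p ^ 2 := by
  have hderiv := hasPartialAt_expEval_div_pow (i := k) (P := metricNumPoly i j) 1
    (expEval_metricDenomPoly_pos hp).ne'
  refine HasPartialAt.partialDeriv_eq (f := fun q => beltMetric q i j)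
    (hderiv.congr_of_eventuallyEq ?_)
  filter_upwards [isOpen_quadrant.mem_nhds hp] with q hq
  rw [pow_one, beltMetric_eq_expEval hq]

lemma partialDeriv_metricDeriv_beltMetric (hp : p ∈ quadrant) (l k i j : Fin 2) :
    partialDeriv l (fun q => metricDeriv beltMetric q k i j) p =
      expEval (metricDeriv₂Num l k i j) p / expEval metricDenomPoly p ^ 3 := by
  have hderiv := hasPartialAt_expEval_div_pow (i := l) (P := metricDerivNum k i j) 2
    (expEval_metricDenomPoly_pos hp).ne'
  refine (hderiv.congr_of_eventuallyEq ?_).partialDeriv_eq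
  filter_upwards [isOpen_quadrant.mem_nhds hp] with q hq
  exact metricDeriv_beltMetric hq k i j

theorem contDiffOn_beltMetric (i j : Fin 2) :
    ContDiffOn ℝ (⊤ : ℕ∞) (fun p => beltMetric p i j) quadrant :=
  (contDiff_expEval.contDiffOn.div contDiff_expEval.contDiffOn fun _ hp =>
    (expEval_metricDenomPoly_pos hp).ne').congr fun _ hp => beltMetric_eq_expEval hp i j

lemma isSymm_beltMetric (hp : p ∈ quadrant) : (beltMetric p).IsSymm := by
  refine Matrix.IsSymm.ext fun i j => ?_
  rw [beltMetric_eq hp, beltMetric_eq hp]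
  fin_cases i <;> fin_cases j <;> rfl

lemma beltMetric_eq_smul (hp : p ∈ quadrant) :
    beltMetric p = (expEval metricDenomPoly p)⁻¹ •
      metricNum (Real.exp (p 0)) (Real.exp (p 1)) := by
  ext i j
  rw [beltMetric_eq hp, Matrix.smul_apply, smul_eq_mul, inv_mul_eq_div, expEval_metricDenomPoly]

/-- The numerator of `beltCurvatureFormula`. -/
def curvatureNum (a b : ℝ) : ℝ :=
  5 + 6 * a + 3 * a ^ 2 + 6 * b + 3 * b ^ 2 + 3 * (a * b) + 45 * (a ^ 2 * b ^ 2)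
    + 19 * (a ^ 3 * b ^ 3) + 11 * (a ^ 2 * b) + 9 * (a ^ 3 * b) + 3 * (a ^ 4 * b)
    + 11 * (a * b ^ 2) + 33 * (a ^ 3 * b ^ 2) + 8 * (a ^ 4 * b ^ 2) + 9 * (a * b ^ 3)
    + 33 * (a ^ 2 * b ^ 3) + 3 * (a ^ 4 * b ^ 3) + 3 * (a * b ^ 4) + 8 * (a ^ 2 * b ^ 4)
    + 3 * (a ^ 3 * b ^ 4)

/-- Brioschi's expression for `beltMetric`, with the denominators cleared. -/
def beltBrioschi (p : Fin 2 → ℝ) : ℝ :=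
  brioschi (metricNum (Real.exp (p 0)) (Real.exp (p 1)))
      (fun k => Matrix.of fun i j => expEval (metricDerivNum k i j) p)
      (expEval (metricDeriv₂Num 0 1 0 1) p - 1 / 2 * expEval (metricDeriv₂Num 1 1 0 0) p -
        1 / 2 * expEval (metricDeriv₂Num 0 0 1 1) p)

lemma beltCurvature_eq_brioschi (hp : p ∈ quadrant) : beltCurvature p =
    beltBrioschi p /
    (expEval metricDenomPoly p * (metricNum (Real.exp (p 0)) (Real.exp (p 1))).det ^ 2) := by
  have hm := (expEval_metricDenomPoly_pos hp).ne'
  have hdet := (det_metricNum_pos (one_lt_exp_zero hp) (one_lt_exp_one hp)).ne'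
  have hsmooth (i j : Fin 2) : ContDiffAt ℝ 2 (fun q => beltMetric q i j) p :=
    ((contDiffOn_beltMetric i j).contDiffAt (isOpen_quadrant.mem_nhds hp)).of_le
      ENat.LEInfty.out
  have hsymm : ∀ᶠ q in 𝓝 p, (beltMetric q).IsSymm := by
    filter_upwards [isOpen_quadrant.mem_nhds hp] with q hq using isSymm_beltMetric hq
  have hderiv : metricDeriv beltMetric p = fun k => (expEval metricDenomPoly p ^ 2)⁻¹ •
      Matrix.of fun i j => expEval (metricDerivNum k i j) p := by
    ext k i j
    rw [metricDeriv_beltMetric hp, Matrix.smul_apply, smul_eq_mul, inv_mul_eq_div, Matrix.of_apply]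
  have hmetric_det : (beltMetric p).det ≠ 0 := by
    rw [beltMetric_eq_smul hp, Matrix.det_smul]
    positivity
  rw [beltCurvature, gaussianCurvature_eq_brioschi hsmooth hsymm hmetric_det, hderiv]
  simp only [partialDeriv_metricDeriv_beltMetric hp]
  rw [beltMetric_eq_smul hp, Matrix.det_smul, Fintype.card_fin, mul_div_assoc', mul_div_assoc',
    ← sub_div, ← sub_div, brioschi_div, beltBrioschi]
  field_simp

lemma pderiv_ofNat (i : Fin 2) (n : ℕ) [n.AtLeastTwo] :
    pderiv i (ofNat(n) : MvPolynomial (Fin 2) ℝ) = 0 :=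
  Derivation.map_natCast _ n

set_option maxHeartbeats 4000000 in
-- `ring` expands an identity between polynomials of degree 37 in two variables
lemma beltBrioschi_mul (p : Fin 2 → ℝ) :
    beltBrioschi p * (4 * (Real.exp (p 0) + 1) ^ 2 * (Real.exp (p 1) + 1) ^ 2 *
        weightPoly (Real.exp (p 0)) (Real.exp (p 1))) =
      curvatureNum (Real.exp (p 0)) (Real.exp (p 1)) *
        (expEval metricDenomPoly p * (metricNum (Real.exp (p 0)) (Real.exp (p 1))).det ^ 2) := by
  rw [det_metricNum]
  simp [beltBrioschi, brioschi, lowerChristoffel, metricDerivNum, metricDeriv₂Num,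
    quotientDerivNum, eulerDeriv, pderiv_ofNat, metricNumPoly, metricDenomPoly, metricNum,
    metricDiag, metricMixed, metricDenom, weightPoly, expEval, curvatureNum, Derivation.leibniz,
    Derivation.leibniz_pow, Matrix.det_fin_two, Matrix.adjugate_fin_two]
  ring

theorem beltCurvature_eq (hp : p ∈ quadrant) :
    beltCurvature p = beltCurvatureFormula (Real.exp (p 0)) (Real.exp (p 1)) := by
  have hdenom := expEval_metricDenomPoly_pos hp
  have hdet := det_metricNum_pos (one_lt_exp_zero hp) (one_lt_exp_one hp)
  have hweight := weightPoly_pos (one_lt_exp_zero hp) (one_lt_exp_one hp)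
  change _ = curvatureNum _ _ / (_ * weightPoly _ _)
  rw [beltCurvature_eq_brioschi hp, div_eq_div_iff (by positivity) (by positivity),
    beltBrioschi_mul]

end Curvature

end BeltBuckle

lemma posDef_of_det_pos {A : Matrix (Fin 2) (Fin 2) ℝ} (hsymm : A.IsSymm) (h00 : 0 < A 0 0)
    (hdet : 0 < A.det) : A.PosDef := by
  refine Matrix.PosDef.of_dotProduct_mulVec_pos
    (Matrix.isHermitian_iff_isSymm.2 hsymm) fun x hx => ?_
  have hsquare : A 0 0 * (star x ⬝ᵥ A.mulVec x) =
      (A 0 0 * x 0 + A 0 1 * x 1) ^ 2 + A.det * x 1 ^ 2 := by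
    simp only [Matrix.mulVec, dotProduct, Fin.sum_univ_two, star_trivial, Matrix.det_fin_two,
      hsymm.apply 0 1]
    ring
  refine pos_of_mul_pos_right (hsquare ▸ ?_) h00.le
  rcases eq_or_ne (x 1) 0 with h1 | h1
  · have h0 : x 0 ≠ 0 := fun h0 => hx (funext fun i => by fin_cases i <;> assumption)
    rw [h1, mul_zero, add_zero]
    positivity
  · positivity

namespace BeltBuckle

section Bounds

variable {a b : ℝ}

lemma half_le_beltCurvatureFormula (ha : 1 < a) (hb : 1 < b) :
    1 / 2 ≤ beltCurvatureFormula a b := by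
  have hweight := weightPoly_pos ha hb
  change 1 / 2 ≤ curvatureNum a b / (4 * (a + 1) ^ 2 * (b + 1) ^ 2 * weightPoly a b)
  rw [le_div_iff₀ (by positivity), ← sub_nonneg]
  -- as a polynomial in `s = a - 1` and `t = b - 1`, the difference has positive coefficients
  obtain ⟨s, hs, rfl⟩ := exists_pos_add_of_lt' ha
  obtain ⟨t, ht, rfl⟩ := exists_pos_add_of_lt' hb
  unfold curvatureNum weightPoly
  ring_nf
  positivity

lemma beltCurvatureFormula_le (ha : 1 < a) (hb : 1 < b) : beltCurvatureFormula a b ≤ 7 / 8 := by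
  have hweight := weightPoly_pos ha hb
  change curvatureNum a b / (4 * (a + 1) ^ 2 * (b + 1) ^ 2 * weightPoly a b) ≤ 7 / 8
  rw [div_le_iff₀ (by positivity), ← sub_nonneg]
  obtain ⟨s, hs, rfl⟩ := exists_pos_add_of_lt' ha
  obtain ⟨t, ht, rfl⟩ := exists_pos_add_of_lt' hb
  unfold curvatureNum weightPoly
  ring_nf
  positivity

lemma abs_beltCurvatureFormula_sub_le (ha : 1 < a) (hb : 1 < b) :
    |beltCurvatureFormula a b - 3 / 4| ≤ a⁻¹ + b⁻¹ := by
  have hweight := weightPoly_pos ha hb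
  have hdenom : 0 < 4 * (a + 1) ^ 2 * (b + 1) ^ 2 * weightPoly a b := by positivity
  have hinv : a⁻¹ + b⁻¹ = (a + b) / (a * b) := by field_simp; ring
  change |curvatureNum a b / (4 * (a + 1) ^ 2 * (b + 1) ^ 2 * weightPoly a b) - 3 / 4| ≤ _
  rw [hinv, div_sub_div _ _ hdenom.ne' four_ne_zero, abs_div,
    abs_of_pos (mul_pos hdenom four_pos), div_le_div_iff₀ (by positivity) (by positivity),
    ← abs_of_pos (show 0 < a * b by positivity), ← abs_mul, abs_le, neg_le_iff_add_nonneg,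
    ← sub_nonneg (b := _ * (a * b))]
  obtain ⟨s, hs, rfl⟩ := exists_pos_add_of_lt' ha
  obtain ⟨t, ht, rfl⟩ := exists_pos_add_of_lt' hb
  unfold curvatureNum weightPoly
  constructor <;> ring_nf <;> positivity

end Bounds

section Metric

variable {p : Fin 2 → ℝ}

theorem posDef_beltMetric (hp : p ∈ quadrant) : (beltMetric p).PosDef := by
  have hdenom := expEval_metricDenomPoly_pos hp
  have hdet := det_metricNum_pos (one_lt_exp_zero hp) (one_lt_exp_one hp)
  refine posDef_of_det_pos (isSymm_beltMetric hp) ?_ ?_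
  · have hdiag : 0 < metricDiag (Real.exp (p 0)) (Real.exp (p 1)) := by
      unfold metricDiag
      positivity
    rw [beltMetric_eq_smul hp]
    exact mul_pos (inv_pos.2 hdenom) hdiag
  · rw [beltMetric_eq_smul hp, Matrix.det_smul]
    positivity

theorem beltCurvature_mem_Icc (hp : p ∈ quadrant) : beltCurvature p ∈ Icc (1 / 2) (7 / 8) := by
  rw [beltCurvature_eq hp]
  exact ⟨half_le_beltCurvatureFormula (one_lt_exp_zero hp) (one_lt_exp_one hp),
    beltCurvatureFormula_le (one_lt_exp_zero hp) (one_lt_exp_one hp)⟩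

theorem tendsto_beltCurvature :
    Tendsto (fun q : ℝ × ℝ => beltCurvature ![q.1, q.2]) (atTop ×ˢ atTop) (𝓝 (3 / 4)) := by
  have hinv : Tendsto (fun x : ℝ => (Real.exp x)⁻¹) atTop (𝓝 0) :=
    tendsto_inv_atTop_zero.comp Real.tendsto_exp_atTop
  have hbound : Tendsto (fun q : ℝ × ℝ => (Real.exp q.1)⁻¹ + (Real.exp q.2)⁻¹)
      (atTop ×ˢ atTop) (𝓝 0) := by
    simpa using (hinv.comp tendsto_fst).add (hinv.comp tendsto_snd)
  rw [tendsto_iff_norm_sub_tendsto_zero]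
  refine squeeze_zero' (.of_forall fun _ => norm_nonneg _) ?_ hbound
  filter_upwards [(eventually_gt_atTop 0).prod_mk (eventually_gt_atTop 0)] with q hq
  have hp : ![q.1, q.2] ∈ quadrant := hq
  rw [beltCurvature_eq hp, Real.norm_eq_abs]
  exact abs_beltCurvatureFormula_sub_le (one_lt_exp_zero hp) (one_lt_exp_one hp)

end Metric

end BeltBuckle

/-! ## The diagonal and incompleteness -/

namespace BeltBuckle

section Diagonal

variable {x : ℝ}

lemma diagonal_mem_quadrant (hx : 0 < x) : ![x, x] ∈ quadrant := ⟨hx, hx⟩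

lemma beltDiagonal_mem_moduliSpace (hx : 0 < x) (hx3 : x < Real.log 3) :
    beltDiagonal x ∈ beltBuckle.moduliSpace := by
  refine beltChart_mem_moduliSpace (diagonal_mem_quadrant hx) ?_
  have hlt : Real.exp x < 3 := (Real.lt_log_iff_exp_lt three_pos).1 hx3
  have hpos := Real.exp_pos x
  simp only [Matrix.cons_val_zero, Matrix.cons_val_one, Real.exp_add]
  nlinarith

lemma beltDiagonal_mem_moduliSpace_of_le_one (hx : 0 < x) (hx1 : x ≤ 1) :
    beltDiagonal x ∈ beltBuckle.moduliSpace :=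
  beltDiagonal_mem_moduliSpace hx
    (hx1.trans_lt ((Real.lt_log_iff_exp_lt three_pos).2 Real.exp_one_lt_three))

lemma eventually_beltDiagonal_notMem {K : Set (Fin 3 → ℝ)} (hK : IsCompact K)
    (hsub : K ⊆ beltBuckle.moduliSpace) : ∀ᶠ x in 𝓝[>] (0 : ℝ), beltDiagonal x ∉ K := by
  rcases K.eq_empty_or_nonempty with rfl | hne
  · simp
  obtain ⟨l, hl, hmin⟩ := hK.exists_isMinOn hne (continuous_apply (0 : Fin 3)).continuousOn
  filter_upwards [nhdsWithin_le_nhds (gt_mem_nhds ((hsub hl).1 0))] with x hx hxK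
  exact absurd (hmin hxK) (not_le.2 hx)

lemma sum_edgeProb_beltDiagonal (hx : 0 < x) : ∑ i, edgeProb (beltDiagonal x) i = 1 :=
  sum_edgeProb_beltChart (diagonal_mem_quadrant hx)

lemma edgeProb_beltDiagonal_two (hx : 0 < x) :
    edgeProb (beltDiagonal x) 2 = (Real.exp x - 1) / (Real.exp x + 1) := by
  refine (edgeProb_beltChart_two (diagonal_mem_quadrant hx)).trans ?_
  simp only [Matrix.cons_val_zero, Matrix.cons_val_one]
  field_simp
  ring

lemma edgeWeight_beltDiagonal_two (hx : 0 < x) :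
    edgeWeight (beltDiagonal x) 2 = 2 * (Real.exp x - 1) / (Real.exp x + 1) ^ 2 := by
  rw [edgeWeight, edgeProb_beltDiagonal_two hx]
  field_simp
  ring

lemma contDiffOn_beltDiagonal : ContDiffOn ℝ 1 beltDiagonal (Ioi 0) := by
  have hdiag : ContDiff ℝ 1 fun x : ℝ => ![x, x] := by
    refine contDiff_pi.2 fun i => ?_
    fin_cases i <;> exact contDiff_id
  exact (contDiffOn_beltChart.of_le (by simp)).comp hdiag.contDiffOn
    fun x hx => diagonal_mem_quadrant hx

lemma hasDerivAt_beltDiagonal (hx : 0 < x) :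
    HasDerivAt beltDiagonal (deriv beltDiagonal x) x :=
  ((contDiffOn_beltDiagonal.contDiffAt (Ioi_mem_nhds hx)).differentiableAt
    one_ne_zero).hasDerivAt

lemma sum_edgeWeight_mul_deriv_beltDiagonal (hx : 0 < x) :
    ∑ i, edgeWeight (beltDiagonal x) i * deriv beltDiagonal x i = 0 := by
  refine sum_edgeWeight_mul_deriv_eq_zero (hasDerivAt_beltDiagonal hx).hasDerivWithinAt
    (isOpen_Ioi.uniqueDiffWithinAt hx) ?_ (sum_edgeProb_beltDiagonal hx)
  exact eventually_nhdsWithin_of_forall fun t ht => sum_edgeProb_beltDiagonal ht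

lemma deriv_beltDiagonal (hx : 0 < x) :
    deriv beltDiagonal x = ![1, 1, -(Real.exp x / (Real.exp x - 1))] := by
  have hexp : 0 < Real.exp x - 1 := sub_pos.2 (Real.one_lt_exp_iff.2 hx)
  have hcoord := hasDerivAt_pi.1 (hasDerivAt_beltDiagonal hx)
  have h0 : deriv beltDiagonal x 0 = 1 := (hcoord 0).unique (hasDerivAt_id x)
  have h1 : deriv beltDiagonal x 1 = 1 := (hcoord 1).unique (hasDerivAt_id x)
  have h2 : deriv beltDiagonal x 2 = -(Real.exp x / (Real.exp x - 1)) := by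
    have htangent := sum_edgeWeight_mul_deriv_beltDiagonal hx
    rw [Fin.sum_univ_three, h0, h1, edgeWeight_beltDiagonal_two hx, beltDiagonal,
      edgeWeight_beltChart_zero, edgeWeight_beltChart_one] at htangent
    simp only [Matrix.cons_val_zero, Matrix.cons_val_one, add_comm 1 (Real.exp x)] at htangent
    field_simp at htangent ⊢
    linear_combination htangent / 2
  funext i
  fin_cases i
  exacts [h0, h1, h2]

lemma pressureNormSq_deriv_beltDiagonal (hx : 0 < x) :
    beltBuckle.pressureNormSq (beltDiagonal x) (deriv beltDiagonal x) =
      Real.exp x / ((Real.exp x - 1) * (2 * Real.exp x - 1)) := by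
  have hexp : 0 < Real.exp x - 1 := sub_pos.2 (Real.one_lt_exp_iff.2 hx)
  have : 0 < 2 * Real.exp x - 1 := by linarith
  have hq₀ : edgeProb (beltDiagonal x) 0 = 1 / (1 + Real.exp x) := edgeProb_beltChart_zero
  have hq₁ : edgeProb (beltDiagonal x) 1 = 1 / (1 + Real.exp x) := edgeProb_beltChart_one
  have hw₀ : edgeWeight (beltDiagonal x) 0 = Real.exp x / (1 + Real.exp x) ^ 2 :=
    edgeWeight_beltChart_zero
  have hw₁ : edgeWeight (beltDiagonal x) 1 = Real.exp x / (1 + Real.exp x) ^ 2 :=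
    edgeWeight_beltChart_one
  have hsum : ∑ i, edgeWeight (beltDiagonal x) i =
      2 * (2 * Real.exp x - 1) / (Real.exp x + 1) ^ 2 := by
    rw [Fin.sum_univ_three, hw₀, hw₁, edgeWeight_beltDiagonal_two hx]
    field_simp
    ring
  rw [pressureNormSq_eq (sum_edgeProb_beltDiagonal hx) (sum_edgeWeight_mul_deriv_beltDiagonal hx),
    hsum, Fin.sum_univ_three, hw₀, hw₁, edgeWeight_beltDiagonal_two hx, hq₀, hq₁,
    edgeProb_beltDiagonal_two hx, deriv_beltDiagonal hx]
  simp only [Matrix.cons_val]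
  field_simp
  ring

lemma pressureNormSq_deriv_beltDiagonal_le (hx : 0 < x) :
    beltBuckle.pressureNormSq (beltDiagonal x) (deriv beltDiagonal x) ≤ x⁻¹ := by
  have hexp : x + 1 ≤ Real.exp x := Real.add_one_le_exp x
  rw [pressureNormSq_deriv_beltDiagonal hx, ← one_div, div_le_div_iff₀ (by nlinarith) hx]
  nlinarith

theorem lintegral_beltDiagonal_lt_top : ∫⁻ x in Ioc (0 : ℝ) 1, ENNReal.ofReal (Real.sqrt
    (beltBuckle.pressureNormSq (beltDiagonal x) (deriv beltDiagonal x))) < ⊤ := by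
  have hintegral : IntegrableOn (fun x : ℝ => x ^ (-(1 / 2) : ℝ)) (Ioc 0 1) :=
    (intervalIntegrable_iff_integrableOn_Ioc_of_le zero_le_one).1
      (intervalIntegral.intervalIntegrable_rpow' (by norm_num))
  refine (setLIntegral_mono' measurableSet_Ioc fun x hx => ?_).trans_lt
    hintegral.setLIntegral_lt_top
  refine ENNReal.ofReal_le_ofReal
    ((Real.sqrt_le_sqrt (pressureNormSq_deriv_beltDiagonal_le hx.1)).trans ?_)
  rw [Real.sqrt_inv, Real.rpow_neg hx.1.le, Real.sqrt_eq_rpow]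

lemma tendsto_edgeWeight_beltDiagonal_two :
    Tendsto (fun x => edgeWeight (beltDiagonal x) 2) (𝓝[>] 0) (𝓝 0) := by
  have hcont : Continuous fun x : ℝ => 2 * (Real.exp x - 1) / (Real.exp x + 1) ^ 2 :=
    Continuous.div (by fun_prop) (by fun_prop) fun x => by positivity
  have hlim := (hcont.tendsto 0).mono_left (nhdsWithin_le_nhds (s := Ioi 0))
  rw [Real.exp_zero, sub_self, mul_zero, zero_div] at hlim
  exact hlim.congr' (eventually_nhdsWithin_of_forall fun x hx =>
    (edgeWeight_beltDiagonal_two hx).symm)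

end Diagonal

section DiagonalSegment

variable {s s' t : ℝ}

/-- The piece of the diagonal from `x = s²` to `x = s'²`. Near the end of the diagonal the speed
`‖c'(x)‖_P` grows like `x ^ (-1/2)`, so it is bounded in the parameter `√x` used here. -/
def diagonalSegment (s s' t : ℝ) : Fin 3 → ℝ := beltDiagonal (AffineMap.lineMap s s' t ^ 2)

lemma lineMap_mem_Ioc (hs : s ∈ Ioc (0 : ℝ) 1) (hs' : s' ∈ Ioc (0 : ℝ) 1)
    (ht : t ∈ Icc (0 : ℝ) 1) : AffineMap.lineMap s s' t ∈ Ioc (0 : ℝ) 1 :=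
  (convex_Ioc 0 1).lineMap_mem hs hs' ht

lemma isModuliCurve_diagonalSegment (hs : s ∈ Ioc (0 : ℝ) 1) (hs' : s' ∈ Ioc (0 : ℝ) 1) :
    beltBuckle.IsModuliCurve (diagonalSegment s s') (beltDiagonal (s ^ 2))
      (beltDiagonal (s' ^ 2)) := by
  refine ⟨?_, fun t ht => ?_, by simp [diagonalSegment], by simp [diagonalSegment]⟩
  · have hline : ContDiff ℝ 1 fun t : ℝ => AffineMap.lineMap s s' t ^ 2 := by
      simp only [AffineMap.lineMap_apply_module']
      fun_prop
    exact contDiffOn_beltDiagonal.comp hline.contDiffOn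
      fun t ht => pow_pos (lineMap_mem_Ioc hs hs' ht).1 2
  · have hr := lineMap_mem_Ioc hs hs' ht
    exact beltDiagonal_mem_moduliSpace_of_le_one (pow_pos hr.1 2) (pow_le_one₀ hr.1.le hr.2)

lemma hasDerivAt_diagonalSegment (hr : 0 < AffineMap.lineMap s s' t) :
    HasDerivAt (diagonalSegment s s') ((2 * AffineMap.lineMap s s' t * (s' - s)) •
      deriv beltDiagonal (AffineMap.lineMap s s' t ^ 2)) t := by
  have hsq : HasDerivAt (fun u => AffineMap.lineMap s s' u ^ 2)
      (2 * AffineMap.lineMap s s' t * (s' - s)) t := by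
    simpa using AffineMap.hasDerivAt_lineMap.fun_pow 2
  exact HasDerivAt.scomp (h := fun u => AffineMap.lineMap s s' u ^ 2) t
    (hasDerivAt_beltDiagonal (pow_pos hr 2)) hsq

lemma pressureNormSq_diagonalSegment_le (hr : 0 < AffineMap.lineMap s s' t) :
    beltBuckle.pressureNormSq (diagonalSegment s s' t)
      ((2 * AffineMap.lineMap s s' t * (s' - s)) •
        deriv beltDiagonal (AffineMap.lineMap s s' t ^ 2)) ≤ (2 * |s' - s|) ^ 2 := by
  rw [diagonalSegment, pressureNormSq_smul (sum_edgeProb_beltDiagonal (pow_pos hr 2))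
    (sum_edgeWeight_mul_deriv_beltDiagonal (pow_pos hr 2))]
  generalize AffineMap.lineMap s s' t = r at hr ⊢
  calc _ ≤ (2 * r * (s' - s)) ^ 2 * (r ^ 2)⁻¹ := by
        gcongr
        exact pressureNormSq_deriv_beltDiagonal_le (pow_pos hr 2)
    _ = (2 * |s' - s|) ^ 2 := by
        rw [mul_pow 2 |s' - s|, sq_abs]
        field_simp

lemma pressureDist_beltDiagonal_sq_le (hs : s ∈ Ioc (0 : ℝ) 1) (hs' : s' ∈ Ioc (0 : ℝ) 1) :
    beltBuckle.pressureDist (beltDiagonal (s ^ 2)) (beltDiagonal (s' ^ 2)) ≤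
      ENNReal.ofReal (2 * |s' - s|) := by
  calc _ ≤ beltBuckle.pressureLength (diagonalSegment s s') :=
        iInf₂_le (f := fun γ (_ : beltBuckle.IsModuliCurve γ _ _) => beltBuckle.pressureLength γ)
          _ (isModuliCurve_diagonalSegment hs hs')
    _ ≤ ∫⁻ _ in Icc (0 : ℝ) 1, ENNReal.ofReal (2 * |s' - s|) := by
        refine setLIntegral_mono' measurableSet_Icc fun t ht => ENNReal.ofReal_le_ofReal ?_
        have hr := (lineMap_mem_Ioc hs hs' ht).1
        rw [(hasDerivAt_diagonalSegment hr).hasDerivWithinAt.derivWithin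
          (uniqueDiffOn_Icc zero_lt_one t ht)]
        exact Real.sqrt_le_iff.2 ⟨by positivity, pressureNormSq_diagonalSegment_le hr⟩
    _ = ENNReal.ofReal (2 * |s' - s|) := by simp

end DiagonalSegment

section Incompleteness

variable {l φ : Fin 3 → ℝ}

lemma edgeProb_lt_half {i : Fin 3} (hi : 0 < l i) : edgeProb l i < 1 / 2 := by
  rw [edgeProb, one_div_lt_one_div (by positivity) two_pos]
  linarith [Real.one_lt_exp_iff.2 hi]

lemma edgeWeight_le_edgeProb (i : Fin 3) : edgeWeight l i ≤ edgeProb l i :=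
  mul_le_of_le_one_right (edgeProb_pos l i).le (sub_le_self 1 (edgeProb_pos l i).le)

lemma sum_edgeWeight_le_one (hl : ∑ i, edgeProb l i = 1) : ∑ i, edgeWeight l i ≤ 1 :=
  hl ▸ Finset.sum_le_sum fun i _ => edgeWeight_le_edgeProb i

lemma sq_le_pressureNormSq (hl : l ∈ beltBuckle.moduliSpace)
    (hφ : ∑ i, edgeWeight l i * φ i = 0) (i : Fin 3) :
    ((1 - 2 * edgeProb l i) * (edgeWeight l i * φ i)) ^ 2 ≤ beltBuckle.pressureNormSq l φ := by
  obtain ⟨hpos, hsum⟩ := mem_moduliSpace_iff.1 hl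
  have hw := edgeWeight_pos l
  have hfactor (j : Fin 3) : 0 < 1 - 2 * edgeProb l j := by linarith [edgeProb_lt_half (hpos j)]
  have hterm (j : Fin 3) : 0 ≤ edgeWeight l j * ((1 - 2 * edgeProb l j) * φ j ^ 2) :=
    mul_nonneg (hw j).le (mul_nonneg (hfactor j).le (sq_nonneg _))
  have hle : (1 - 2 * edgeProb l i) * edgeWeight l i ≤ 1 := by
    have hq := edgeProb_pos l i
    have hw1 := edgeWeight_le_edgeProb (l := l) i
    exact mul_le_one₀ (by linarith) (hw i).le (by linarith [hfactor i])
  calc ((1 - 2 * edgeProb l i) * (edgeWeight l i * φ i)) ^ 2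
      = (1 - 2 * edgeProb l i) * edgeWeight l i *
        (edgeWeight l i * ((1 - 2 * edgeProb l i) * φ i ^ 2)) := by ring
    _ ≤ edgeWeight l i * ((1 - 2 * edgeProb l i) * φ i ^ 2) :=
        mul_le_of_le_one_left (hterm i) hle
    _ ≤ ∑ j, edgeWeight l j * ((1 - 2 * edgeProb l j) * φ j ^ 2) :=
        Finset.single_le_sum (fun j _ => hterm j) (Finset.mem_univ i)
    _ ≤ beltBuckle.pressureNormSq l φ := by
        rw [pressureNormSq_eq hsum hφ]
        exact le_div_self (Finset.sum_nonneg fun j _ => hterm j) (sum_edgeWeight_pos l)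
          (sum_edgeWeight_le_one hsum)

lemma contDiff_edgeWeight (i : Fin 3) : ContDiff ℝ 1 fun l => edgeWeight l i := by
  have hq : ContDiff ℝ 1 fun l : Fin 3 → ℝ => edgeProb l i :=
    contDiff_const.div (by fun_prop) fun l => by positivity
  exact hq.mul (contDiff_const.sub hq)

lemma hasDerivWithinAt_edgeWeight {γ : ℝ → Fin 3 → ℝ} {γ' : Fin 3 → ℝ} {s : Set ℝ} {t : ℝ}
    (hγ : HasDerivWithinAt γ γ' s t) (i : Fin 3) :
    HasDerivWithinAt (fun u => edgeWeight (γ u) i)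
      (-((1 - 2 * edgeProb (γ t) i) * (edgeWeight (γ t) i * γ' i))) s t := by
  have hq := hasDerivWithinAt_edgeProb hγ i
  refine (hq.fun_mul (hq.const_sub 1)).congr_deriv ?_
  ring

lemma sum_edgeWeight_mul_derivWithin_eq_zero {γ : ℝ → Fin 3 → ℝ} {γ' : Fin 3 → ℝ} {t : ℝ}
    (hmaps : MapsTo γ (Icc 0 1) beltBuckle.moduliSpace) (ht : t ∈ Icc (0 : ℝ) 1)
    (hγ : HasDerivWithinAt γ γ' (Icc 0 1) t) : ∑ i, edgeWeight (γ t) i * γ' i = 0 :=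
  sum_edgeWeight_mul_deriv_eq_zero hγ (uniqueDiffOn_Icc zero_lt_one t ht)
    (eventually_nhdsWithin_of_forall fun _ hu => (mem_moduliSpace_iff.1 (hmaps hu)).2)
    (mem_moduliSpace_iff.1 (hmaps ht)).2

lemma edist_edgeWeight_le_pressureDist (l₁ l₂ : Fin 3 → ℝ) (i : Fin 3) :
    edist (edgeWeight l₁ i) (edgeWeight l₂ i) ≤ beltBuckle.pressureDist l₁ l₂ := by
  refine le_iInf₂ fun γ hγ => ?_
  obtain ⟨hsmooth, hmaps, rfl, rfl⟩ := hγ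
  rw [edist_comm, edist_eq_enorm_sub]
  have hweight : ContDiffOn ℝ 1 (fun t => edgeWeight (γ t) i) (Icc 0 1) :=
    (contDiff_edgeWeight i).comp_contDiffOn hsmooth
  refine (enorm_sub_le_lintegral_derivWithin_Icc_of_contDiffOn_Icc hweight zero_le_one).trans
    (setLIntegral_mono' measurableSet_Icc fun t ht => ?_)
  have hγ' := (hsmooth.differentiableOn one_ne_zero t ht).hasDerivWithinAt
  rw [(hasDerivWithinAt_edgeWeight hγ' i).derivWithin (uniqueDiffOn_Icc zero_lt_one t ht),
    enorm_neg, Real.enorm_eq_ofReal_abs]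
  exact ENNReal.ofReal_le_ofReal (Real.abs_le_sqrt (sq_le_pressureNormSq (hmaps ht)
    (sum_edgeWeight_mul_derivWithin_eq_zero hmaps ht hγ') i))

lemma exists_forall_pressureDist_beltDiagonal_sq_lt {s : ℕ → ℝ} (hs : ∀ n, s n ∈ Ioc (0 : ℝ) 1)
    (hcauchy : CauchySeq s) {ε : ℝ≥0∞} (hε : 0 < ε) : ∃ N, ∀ m ≥ N, ∀ n ≥ N,
      beltBuckle.pressureDist (beltDiagonal (s m ^ 2)) (beltDiagonal (s n ^ 2)) < ε := by
  obtain ⟨N, hN⟩ := EMetric.cauchySeq_iff.1 hcauchy (ε / 2) (ENNReal.half_pos hε.ne')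
  refine ⟨N, fun m hm n hn => (pressureDist_beltDiagonal_sq_le (hs m) (hs n)).trans_lt ?_⟩
  rw [ENNReal.ofReal_mul zero_le_two, ← Real.enorm_eq_ofReal_abs, ← edist_eq_enorm_sub,
    ENNReal.ofReal_ofNat]
  exact ENNReal.mul_lt_of_lt_div' (hN n hn m hm)

lemma not_tendsto_pressureDist_zero {u : ℕ → Fin 3 → ℝ}
    (hu : Tendsto (fun n => edgeWeight (u n) 2) atTop (𝓝 0)) (l : Fin 3 → ℝ) :
    ¬ Tendsto (fun n => beltBuckle.pressureDist (u n) l) atTop (𝓝 0) := by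
  intro hlim
  have hweight : Tendsto (fun n => edgeWeight (u n) 2) atTop (𝓝 (edgeWeight l 2)) :=
    tendsto_iff_edist_tendsto_0.2 (tendsto_of_tendsto_of_tendsto_of_le_of_le tendsto_const_nhds
      hlim (fun _ => zero_le) fun n => edist_edgeWeight_le_pressureDist (u n) l 2)
  exact (edgeWeight_pos l 2).ne' (tendsto_nhds_unique hweight hu)

theorem not_isPressureComplete : ¬ beltBuckle.IsPressureComplete := by
  intro hcomplete
  let s : ℕ → ℝ := fun n => 1 / ((n : ℝ) + 1)
  have hs (n : ℕ) : s n ∈ Ioc (0 : ℝ) 1 :=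
    ⟨Nat.one_div_pos_of_nat, div_le_one_of_le₀ (by simp) (by positivity)⟩
  have hlim : Tendsto s atTop (𝓝 0) := tendsto_one_div_add_atTop_nhds_zero_nat
  have hsq : Tendsto (fun n => s n ^ 2) atTop (𝓝[>] 0) := by
    refine tendsto_nhdsWithin_iff.2 ⟨?_, Eventually.of_forall fun n => pow_pos (hs n).1 2⟩
    simpa using hlim.pow 2
  obtain ⟨l, -, hl⟩ := hcomplete (fun n => beltDiagonal (s n ^ 2))
    (fun n => beltDiagonal_mem_moduliSpace_of_le_one (pow_pos (hs n).1 2)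
      (pow_le_one₀ (hs n).1.le (hs n).2))
    (fun _ => exists_forall_pressureDist_beltDiagonal_sq_lt hs hlim.cauchySeq)
  exact not_tendsto_pressureDist_zero (tendsto_edgeWeight_beltDiagonal_two.comp hsq) l hl

end Incompleteness

end BeltBuckle

end

theorem proposition4p5 :
    -- the moduli space is the surface parametrized by the chart
    beltBuckle.moduliSpace = beltChart '' {p : Fin 2 → ℝ | 0 < p 0 ∧ 0 < p 1 ∧
        Real.exp (p 0 + p 1) < 3 + Real.exp (p 0) + Real.exp (p 1)} ∧
    -- equilibrium states, variances and tangent vectors are well defined for all `x, y > 0`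
    (∀ p : Fin 2 → ℝ, 0 < p 0 → 0 < p 1 →
      (∃! m : Measure beltBuckle.shiftSpace, beltBuckle.IsEquilibriumState
        (fun x => -beltBuckle.edgeFun (beltChart p) x) m) ∧
      (∀ φ : Fin 3 → ℝ, Tendsto
        (beltBuckle.varianceSeq (beltBuckle.edgeFun φ) (beltBuckle.edgeState (beltChart p)))
        atTop (𝓝 (beltBuckle.pressureNormSq (beltChart p) φ))) ∧
      (∀ i, partialDeriv i beltChart p ∈ beltBuckle.tangentSpace (beltChart p))) ∧
    -- the first fundamental form is a smooth Riemannian metric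
    (∀ i j, ContDiffOn ℝ (⊤ : ℕ∞) (fun p => beltMetric p i j)
      {p : Fin 2 → ℝ | 0 < p 0 ∧ 0 < p 1}) ∧
    (∀ p : Fin 2 → ℝ, 0 < p 0 → 0 < p 1 → (beltMetric p).PosDef) ∧
    -- the curvature lies between two positive constants on the moduli space
    (∃ c₀ c₁ : ℝ, 0 < c₀ ∧ ∀ l ∈ beltBuckle.moduliSpace,
      c₀ ≤ beltCurvature ![l 0, l 1] ∧ beltCurvature ![l 0, l 1] ≤ c₁) ∧
    -- the explicit curvature, and its limit
    (∀ p : Fin 2 → ℝ, 0 < p 0 → 0 < p 1 →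
      beltCurvature p = beltCurvatureFormula (Real.exp (p 0)) (Real.exp (p 1))) ∧
    Tendsto (fun q : ℝ × ℝ => beltCurvature ![q.1, q.2]) (atTop ×ˢ atTop) (𝓝 (3 / 4)) ∧
    -- incompleteness
    ¬ beltBuckle.IsPressureComplete ∧
    -- the diagonal path leaves every compact subset of the moduli space in finite length
    (∀ x : ℝ, 0 < x → x < Real.log 3 → beltDiagonal x ∈ beltBuckle.moduliSpace) ∧
    (∀ K : Set (Fin 3 → ℝ), IsCompact K → K ⊆ beltBuckle.moduliSpace →
      ∀ᶠ x in 𝓝[>] (0 : ℝ), beltDiagonal x ∉ K) ∧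
    ∫⁻ x in Ioc (0 : ℝ) 1, ENNReal.ofReal (Real.sqrt
      (beltBuckle.pressureNormSq (beltDiagonal x) (deriv beltDiagonal x))) < ⊤ := by
  refine ⟨BeltBuckle.moduliSpace_eq, fun p hx hy => ?_, BeltBuckle.contDiffOn_beltMetric,
    fun p hx hy => BeltBuckle.posDef_beltMetric ⟨hx, hy⟩, ⟨1 / 2, 7 / 8, one_half_pos, ?_⟩,
    fun p hx hy => BeltBuckle.beltCurvature_eq ⟨hx, hy⟩, BeltBuckle.tendsto_beltCurvature,
    BeltBuckle.not_isPressureComplete, fun x => BeltBuckle.beltDiagonal_mem_moduliSpace,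
    fun K => BeltBuckle.eventually_beltDiagonal_notMem, BeltBuckle.lintegral_beltDiagonal_lt_top⟩
  · have hp : p ∈ BeltBuckle.quadrant := ⟨hx, hy⟩
    have hl := BeltBuckle.sum_edgeProb_beltChart hp
    exact ⟨BeltBuckle.existsUnique_isEquilibriumState hl,
      BeltBuckle.tendsto_varianceSeq_pressureNormSq hl, fun i =>
      (BeltBuckle.mem_tangentSpace_iff hl).2 (BeltBuckle.sum_edgeWeight_mul_partialDeriv hp i)⟩
  · intro l hl
    have hpos := (BeltBuckle.mem_moduliSpace_iff.1 hl).1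
    exact BeltBuckle.beltCurvature_mem_Icc ⟨hpos 0, hpos 1⟩
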